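/- Let $\Bbbk$ be an algebraically closed field, let $n$ and $a$ be integers with $1\le a\le n-1$, $\gcd(a,n)=1$, and $n$ invertible in $\Bbbk$, and let $\zeta\in\Bbbk$ be a primitive $n$-th root of unity. Let $\sigma$ act on $S=\Bbbk[[x,y]]$ by $x\mapsto\zeta x$, $y\mapsto\zeta^a y$, let $G=\langle\sigma\rangle$ and let $R=S^G$, a local ring with maximal ideal $\mathfrak m$. For $t=0,1,\dots,n-1$ let $M_t$ be the $R$-module of all $f\in S$ with $\sigma f=\zeta^t f$, i.e. of all power series in the monomials $x^iy^j$ with $i+ja\equiv t \pmod n$. Let $\mu_R(M)=\dim_{R/\mathfrak m}M/\mathfrak mM$, let $\mathrm e(M)=\lim_{m\to\infty}\frac{d!}{m^d}\,\ell_R(M/\mathfrak m^mM)$ with $d=\dim R$ be the multiplicity of $M$ with respect to $\mathfrak m$, and call $M$ an Ulrich module if $M$ is a maximal Cohen–Macaulay $R$-module (finitely generated with $\operatorname{depth}_R M=\dim R$) and $\mu_R(M)=\mathrm e(M)$. Let $$\frac na=[\alpha_1,\dots,\alpha_r]=\alpha_1-\cfrac{1}{\alpha_2-\cfrac{1}{\cdots-\frac1{\alpha_r}}}\qquad(\alpha_u\ge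 2)$$ be the Hirzebruch–Jung continued fraction expansion, and define $i_0=n$, $i_1=a$, $i_u=\alpha_{u-1}i_{u-1}-i_{u-2}$ for $u\ge2$. For $0\le t\le n-1$ define integers $d_1,\dots,d_r\ge 0$ by successive division with remainder: $h_0=t$ and $h_{u-1}=d_ui_u+h_u$ with $0\le h_u<i_u$ for $u=1,\dots,r$. Then, for every $t=0,1,\dots,n-1$, the limits defining $\mathrm e(R)$ and $\mathrm e(M_t)$ exist, $\mathrm e(R)=\alpha_1+\cdots+\alpha_r-2(r-1)$, and $$\mu_R(M_t)=\mathrm e(R)-s\iff d_1+\cdots+d_r=\mathrm e(R)-(s+1)\qquad\text{for } s=0,1,\dots,\mathrm e(R)-1.$$ In particular, $M_t$ is an Ulrich $R$-module if and only if $d_1+\cdots+d_r=\mathrm e(R)-1$. -/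

import Mathlib

open Filter Topology

namespace CyclicQuotient

noncomputable section

/-! ### Generators, multiplicity, depth and Ulrich modules over a local ring -/

section LocalRing

variable (R : Type*) [CommRing R] [IsLocalRing R] (M : Type*) [AddCommGroup M] [Module R M]

/-- `μ_R(M) = dim_{R/𝔪} (M / 𝔪 M)`, the minimal number of generators of `M`. -/
def mu : ℕ :=
  Module.finrank (R ⧸ IsLocalRing.maximalIdeal R)
    (M ⧸ (IsLocalRing.maximalIdeal R • (⊤ : Submodule R M)))

/-- The Krull dimension of `R` as a natural number (used for Noetherian local `R`, where the
dimension is finite and nonnegative). -/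
def dim : ℕ := ((ringKrullDim R).unbotD 0).toNat

/-- `d! · ℓ_R(M / 𝔪 ^ m M) / m ^ d` with `d = dim R`. -/
def hilbertSamuelRatio (m : ℕ) : ℝ :=
  ((dim R).factorial : ℝ) *
    ((Module.length R
      (M ⧸ ((IsLocalRing.maximalIdeal R) ^ m • (⊤ : Submodule R M)))).toNat : ℝ) /
    (m : ℝ) ^ (dim R)

/-- The multiplicity `e(M)` of `M` with respect to the maximal ideal `𝔪`:
`lim_{m → ∞} d! · ℓ_R(M / 𝔪 ^ m M) / m ^ d` with `d = dim R`. -/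
def mult : ℝ := limUnder atTop (hilbertSamuelRatio R M)

/-- The depth of `M`: the supremum of the lengths of the `M`-regular sequences in `𝔪`. -/
def depth : ℕ∞ :=
  ⨆ (rs : List R) (_ : (∀ x ∈ rs, x ∈ IsLocalRing.maximalIdeal R) ∧
    RingTheory.Sequence.IsRegular M rs), (rs.length : ℕ∞)

/-- Maximal Cohen-Macaulay modules: finitely generated modules with `depth M = dim R`. -/
structure IsMCM : Prop where
  finite : Module.Finite R M
  depth_eq : (depth R M : WithBot ℕ∞) = ringKrullDim R

/-- Ulrich modules: maximal Cohen-Macaulay modules with `μ_R(M) = e(M)`. -/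
structure IsUlrich : Prop where
  isMCM : IsMCM R M
  mu_eq : (mu R M : ℝ) = mult R M

end LocalRing

/-! ### The cyclic quotient singularity `1/n(1,a)` and its modules `M_t` -/

section Quotient

variable {k : Type*} [Field k]

/-- The action of the generator `σ = diag(ζ, ζ ^ a)` on `k[[x, y]]`: `x ↦ ζ x`, `y ↦ ζ ^ a y`. -/
def sigma (ζ : k) (a : ℕ) : MvPowerSeries (Fin 2) k →ₐ[k] MvPowerSeries (Fin 2) k :=
  MvPowerSeries.rescaleAlgHom ![ζ, ζ ^ a]

/-- The invariant ring `k[[x, y]]^G`, where `G` is the group generated by `σ`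
(so that being fixed by `G` is the same as being fixed by `σ`). -/
def invariantRing (ζ : k) (a : ℕ) : Subalgebra k (MvPowerSeries (Fin 2) k) where
  carrier := {f | sigma ζ a f = f}
  mul_mem' {f g} hf hg := by
    simp only [Set.mem_ofPred_eq] at hf hg ⊢
    rw [map_mul, hf, hg]
  add_mem' {f g} hf hg := by
    simp only [Set.mem_ofPred_eq] at hf hg ⊢
    rw [map_add, hf, hg]
  algebraMap_mem' c := (sigma ζ a).commutes c

lemma mem_invariantRing {ζ : k} {a : ℕ} {f : MvPowerSeries (Fin 2) k} :
    f ∈ invariantRing ζ a ↔ sigma ζ a f = f := Iff.rfl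

instance isLocalRing_invariantRing (ζ : k) (a : ℕ) : IsLocalRing (invariantRing ζ a) := by
  have : IsLocalHom (invariantRing ζ a).val.toRingHom := by
    refine ⟨fun f hf => ?_⟩
    obtain ⟨g, hg⟩ := hf.exists_right_inv
    change (f : MvPowerSeries (Fin 2) k) * g = 1 at hg
    have h1 : (f : MvPowerSeries (Fin 2) k) * sigma ζ a g = 1 := by
      have h2 := congrArg (sigma ζ a) hg
      rwa [map_mul, map_one, mem_invariantRing.1 f.2] at h2
    have h3 : sigma ζ a g = g := by
      calc sigma ζ a g = (f * g) * sigma ζ a g := by rw [hg, one_mul]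
        _ = g * (f * sigma ζ a g) := by ring
        _ = g := by rw [h1, mul_one]
    exact IsUnit.of_mul_eq_one ⟨g, h3⟩ (Subtype.ext hg)
  exact RingHom.domain_isLocalRing (invariantRing ζ a).val.toRingHom

/-- The module `M_t = (k[[x, y]] ⊗ V_t)^G`, where `V_t` is the character `σ ↦ ζ ^ (-t)` of `G`:
the power series `f` with `σ f = ζ ^ t f`, that is, those that involve only monomials
`x ^ i y ^ j` with `i + j a ≡ t (mod n)` when `ζ` is a primitive `n`-th root of unity. -/
def M (ζ : k) (a t : ℕ) : Submodule (invariantRing ζ a) (MvPowerSeries (Fin 2) k) where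
  carrier := {f | sigma ζ a f = ζ ^ t • f}
  add_mem' {f g} hf hg := by
    simp only [Set.mem_ofPred_eq] at hf hg ⊢
    rw [map_add, hf, hg, smul_add]
  zero_mem' := by simp
  smul_mem' c f hf := by
    simp only [Set.mem_ofPred_eq] at hf ⊢
    change sigma ζ a ((c : MvPowerSeries (Fin 2) k) * f) =
      ζ ^ t • ((c : MvPowerSeries (Fin 2) k) * f)
    rw [map_mul, mem_invariantRing.1 c.2, hf, mul_smul_comm]

end Quotient

/-! ### Hirzebruch-Jung continued fractions and the `i`-series -/

/-- `hjFrac α u m` is `[α_u, α_{u+1}, …, α_{u+m-1}] = α_u - 1/(α_{u+1} - 1/(⋯ - 1/α_{u+m-1}))`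
(with `m ≥ 1` entries; the value for `m = 0` is not used). -/
def hjFrac (α : ℕ → ℕ) : ℕ → ℕ → ℚ
  | _, 0 => 0
  | u, 1 => α u
  | u, m + 2 => α u - 1 / hjFrac α (u + 1) (m + 1)

/-- `n / a = [α_1, …, α_r]` is the Hirzebruch-Jung continued fraction expansion of `n / a`
(whose entries are integers `≥ 2`). -/
structure IsHJExpansion (n a r : ℕ) (α : ℕ → ℕ) : Prop where
  one_le : 1 ≤ r
  two_le : ∀ u ∈ Finset.Icc 1 r, 2 ≤ α u
  eq : (n : ℚ) / a = hjFrac α 1 r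

/-- The `i`-series: `i_0 = n`, `i_1 = a`, `i_u = α_{u-1} i_{u-1} - i_{u-2}` for `u ≥ 2`. -/
def iSeries (n a : ℕ) (α : ℕ → ℕ) : ℕ → ℤ
  | 0 => n
  | 1 => a
  | u + 2 => α (u + 1) * iSeries n a α (u + 1) - iSeries n a α u

/-- The successive remainders: `h_0 = t`, and `h_{u+1}` is the remainder of `h_u` modulo
`i_{u+1}`. -/
def remainder (i : ℕ → ℤ) (t : ℕ) : ℕ → ℤ
  | 0 => t
  | u + 1 => remainder i t u % i (u + 1)

/-- The successive quotients: `h_{u-1} = d_u i_u + h_u` for `u ≥ 1` (`d_0` is not used). -/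
def digit (i : ℕ → ℤ) (t : ℕ) : ℕ → ℤ
  | 0 => 0
  | u + 1 => remainder i t u / i (u + 1)

end

end CyclicQuotient

namespace CyclicQuotient

/-! ### The `i`-series, the `j`-series and greedy expansions -/

/-! To a monomial x^i y^j of M_t attach its levels y_0 = j, y_1 = (i + ja - t)/n and y_{u+1} = α_u
y_u - y_{u-1} + d_u. They are integers, nonnegative up to index r + 1, with y_{r+1} = i, and any two
consecutive levels determine the monomial (`eq_level`, `levelPoint`). Since α_u ≥ 2 and d_u ≥ 0, the
sequence is convex wherever it is nonnegative. A local minimum therefore controls the whole sequence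
(`IsHJData.of_local_min`).

Two combinatorial facts carry the proof. First, 𝔪^p M_t consists of the series whose monomials have
y_1, …, y_r ≥ p. A nonconstant invariant monomial has all these levels ≥ 1, and levels add under
multiplication, which gives one inclusion. Conversely, if all levels are at least p + 1, an
invariant monomial of level 1 at the place of the minimum can be split off (`IsHJData.exists_sub`).
Second, with e = ∑ α_u - 2(r - 1), exactly e·p + ∑ d_u + 1 monomials have smallest level p
(`IsHJData.exists_layer`).

Hence ℓ(M_t/𝔪^m M_t) = e·m(m-1)/2 + (∑ d_u + 1)m. As dim R = 2, the multiplicity is e for every t,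
including M_0 = R, while m = 1 gives μ(M_t) = ∑ d_u + 1. The equivalences are then arithmetic. The
regular sequence x^n, y^n gives both the dimension and the Cohen–Macaulay property. -/

lemma one_lt_hjFrac (α : ℕ → ℕ) (m u : ℕ) (h : ∀ w, u ≤ w → w ≤ u + m → 2 ≤ α w) :
    1 < hjFrac α u (m + 1) := by
  induction m generalizing u with
  | zero =>
    have h2 : (2 : ℚ) ≤ α u := by exact_mod_cast h u le_rfl le_rfl
    simp only [hjFrac]
    linarith
  | succ m ih =>
    have h2 : (2 : ℚ) ≤ α u := by exact_mod_cast h u le_rfl (by omega)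
    have h1 := ih (u + 1) fun w hw hw' => h w (by omega) (by omega)
    have h3 : 1 / hjFrac α (u + 1) (m + 1) < 1 := by
      rw [div_lt_one (by linarith)]
      exact h1
    simp only [hjFrac]
    linarith

/-- The numerical data of a Hirzebruch-Jung expansion `n / a = [α_1, …, α_r]` in lowest terms. -/
structure IsHJData (n a r : ℕ) (α : ℕ → ℕ) : Prop where
  one_le : 1 ≤ r
  n_pos : 0 < n
  two_le : ∀ u, 1 ≤ u → u ≤ r → 2 ≤ α u
  i_pos : ∀ u, u ≤ r → 0 < iSeries n a α u
  i_last : iSeries n a α r = 1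
  i_end : iSeries n a α (r + 1) = 0

/-- By induction i_w / i_{w+1} = [α_{w+1}, …, α_r], and such a fraction exceeds 1, so the i-series
stays positive. The recursion preserves coprimality of neighbours. At the end i_{r-1} = α_r i_r, so
i_r divides both of two coprime numbers and equals 1. -/
lemma IsHJExpansion.isHJData {n a r : ℕ} {α : ℕ → ℕ} (h : IsHJExpansion n a r α)
    (ha : 1 ≤ a) (han : a < n) (hcop : Nat.Coprime a n) : IsHJData n a r α := by
  have key : ∀ w, w < r → (iSeries n a α w : ℚ) = hjFrac α (w + 1) (r - w) *
      (iSeries n a α (w + 1) : ℚ) ∧ 0 < iSeries n a α (w + 1) ∧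
      IsCoprime (iSeries n a α w) (iSeries n a α (w + 1)) := by
    intro w
    induction w with
    | zero =>
      intro _
      have ha' : (a : ℚ) ≠ 0 := by positivity
      refine ⟨?_, by simp only [iSeries]; omega, ?_⟩
      · have := h.eq
        rw [div_eq_iff ha'] at this
        simpa [iSeries] using this
      · simpa [iSeries] using Nat.isCoprime_iff_coprime.2 hcop.symm
    | succ w ih =>
      intro hw
      obtain ⟨h1, h2, h3⟩ := ih (by omega)
      obtain ⟨m, hm⟩ : ∃ m, r - w = m + 2 := ⟨r - w - 2, by omega⟩
      have hm' : r - (w + 1) = m + 1 := by omega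
      have hf := one_lt_hjFrac α m (w + 2) fun v hv hv' =>
        h.two_le v (Finset.mem_Icc.2 ⟨by omega, by omega⟩)
      have hrec : iSeries n a α (w + 2) = α (w + 1) * iSeries n a α (w + 1) - iSeries n a α w := rfl
      have hq : (iSeries n a α (w + 2) : ℚ) =
          iSeries n a α (w + 1) / hjFrac α (w + 2) (m + 1) := by
        rw [hrec]
        push_cast
        rw [h1, hm]
        simp only [hjFrac]
        ring
      rw [hm']
      refine ⟨?_, ?_, ?_⟩
      · rw [hq]
        field_simp
      · have : (0 : ℚ) < iSeries n a α (w + 2) := by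
          rw [hq]
          have : (0 : ℚ) < iSeries n a α (w + 1) := by exact_mod_cast h2
          positivity
        exact_mod_cast this
      · rw [hrec]
        have : (α (w + 1) : ℤ) * iSeries n a α (w + 1) - iSeries n a α w =
          -iSeries n a α w + iSeries n a α (w + 1) * α (w + 1) := by ring
        rw [this]
        exact (IsCoprime.add_mul_left_right_iff).2 h3.symm.neg_right
  obtain ⟨s, rfl⟩ : ∃ s, r = s + 1 := ⟨r - 1, by have := h.one_le; omega⟩
  obtain ⟨h1, h2, h3⟩ := key s (by omega)
  have hend : iSeries n a α (s + 2) = 0 := by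
    have hs : s + 1 - s = 1 := by omega
    rw [hs] at h1
    simp only [hjFrac] at h1
    have h1' : iSeries n a α s = α (s + 1) * iSeries n a α (s + 1) := by exact_mod_cast h1
    simp only [iSeries]
    omega
  refine ⟨h.one_le, by omega, fun u hu hu' => h.two_le u (Finset.mem_Icc.2 ⟨hu, hu'⟩), ?_, ?_, hend⟩
  · rintro (_ | u) hu
    · simp only [iSeries]; omega
    · exact (key u (by omega)).2.1
  · have h4 : iSeries n a α s = iSeries n a α (s + 1) * α (s + 1) := by
      simp only [iSeries] at hend
      linarith
    rw [h4] at h3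
    have := h3.isUnit_of_dvd' (Dvd.intro _ rfl) dvd_rfl
    rcases Int.isUnit_iff.1 this with h | h <;> omega

/-- The `j`-series: `j_0 = 0`, `j_1 = 1`, `j_u = α_{u-1} j_{u-1} - j_{u-2}`. -/
def jSeries (α : ℕ → ℕ) : ℕ → ℤ
  | 0 => 0
  | 1 => 1
  | u + 2 => α (u + 1) * jSeries α (u + 1) - jSeries α u

/-- Both series satisfy the same recursion, so this determinant does not depend on u. It is the
determinant of the linear system relating exponents to two consecutive levels. -/
lemma jSeries_det (n a : ℕ) (α : ℕ → ℕ) (u : ℕ) :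
    jSeries α (u + 1) * iSeries n a α u - jSeries α u * iSeries n a α (u + 1) = n := by
  induction u with
  | zero => simp [jSeries, iSeries]
  | succ u ih =>
    simp only [jSeries, iSeries]
    linear_combination ih

namespace IsHJData

variable {n a r : ℕ} {α : ℕ → ℕ}

lemma jSeries_lt (D : IsHJData n a r α) : ∀ u, u ≤ r → 0 ≤ jSeries α u ∧
    jSeries α u < jSeries α (u + 1) := by
  intro u
  induction u with
  | zero => simp [jSeries]
  | succ u ih =>
    intro hu
    obtain ⟨h1, h2⟩ := ih (by omega)
    have h3 : (2 : ℤ) ≤ α (u + 1) := by exact_mod_cast D.two_le (u + 1) (by omega) hu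
    refine ⟨by omega, ?_⟩
    simp only [jSeries]
    nlinarith

lemma jSeries_pos (D : IsHJData n a r α) (u : ℕ) (h1 : 1 ≤ u) (hu : u ≤ r) : 0 < jSeries α u := by
  obtain ⟨w, rfl⟩ : ∃ w, u = w + 1 := ⟨u - 1, by omega⟩
  have := D.jSeries_lt w (by omega)
  omega

lemma remainder_bounds (D : IsHJData n a r α) {t : ℕ} (ht : t < n) : ∀ u, u ≤ r →
    0 ≤ remainder (iSeries n a α) t u ∧ remainder (iSeries n a α) t u < iSeries n a α u := by
  rintro (_ | u) hu
  · simp only [remainder, iSeries]; omega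
  · have := D.i_pos (u + 1) hu
    exact ⟨Int.emod_nonneg _ this.ne', Int.emod_lt_of_pos _ this⟩

lemma digit_nonneg (D : IsHJData n a r α) {t : ℕ} (ht : t < n) (u : ℕ) (hu : u ≤ r) :
    0 ≤ digit (iSeries n a α) t u := by
  rcases u with _ | u
  · simp [digit]
  · exact Int.ediv_nonneg (D.remainder_bounds ht u (by omega)).1 (D.i_pos _ hu).le

end IsHJData

lemma remainder_succ (i : ℕ → ℤ) (t u : ℕ) :
    remainder i t (u + 1) = remainder i t u - digit i t (u + 1) * i (u + 1) := by
  simp only [remainder, digit]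
  rw [Int.emod_def]
  ring

lemma remainder_zero (i : ℕ → ℤ) (u : ℕ) : remainder i 0 u = 0 := by
  induction u with
  | zero => simp [remainder]
  | succ u ih => simp [remainder, ih]

lemma digit_zero (i : ℕ → ℤ) (u : ℕ) : digit i 0 u = 0 := by
  cases u <;> simp [digit, remainder_zero]

/-! ### The levels of a monomial -/

/-- The sequence of levels of the monomial `x ^ i y ^ j` of `M_t`. Up to a shift that makes the
smallest value `0`, the `u`-th level is the order of vanishing along the `u`-th exceptional curve
of the minimal resolution. -/
def level (n a : ℕ) (α : ℕ → ℕ) (t : ℕ) (i j : ℤ) : ℕ → ℤ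
  | 0 => j
  | 1 => (i + j * a - t) / n
  | u + 2 => α (u + 1) * level n a α t i j (u + 1) - level n a α t i j u +
      digit (iSeries n a α) t (u + 1)

/-- `∑_{w ≤ u} d_w j_w`. -/
def jSum (n a : ℕ) (α : ℕ → ℕ) (t : ℕ) : ℕ → ℤ
  | 0 => 0
  | u + 1 => jSum n a α t u + digit (iSeries n a α) t (u + 1) * jSeries α (u + 1)

section Level

variable {n a r : ℕ} {α : ℕ → ℕ} {t : ℕ}

lemma jSum_zero (u : ℕ) : jSum n a α 0 u = 0 := by
  induction u with
  | zero => rfl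
  | succ u ih => simp [jSum, ih, digit_zero]

lemma level_rec (i j : ℤ) (u : ℕ) : level n a α t i j u + level n a α t i j (u + 2) =
    α (u + 1) * level n a α t i j (u + 1) + digit (iSeries n a α) t (u + 1) := by
  simp only [level]
  ring

/-- The term d_{u+1} in the recursion for the levels is exactly what turns h_u into h_{u+1} in the
first formula and enlarges `jSum` in the second. -/
lemma eq_level {i j : ℤ} (h : (n : ℤ) ∣ i + j * a - t) (u : ℕ) :
    i = remainder (iSeries n a α) t u - level n a α t i j u * iSeries n a α (u + 1) +
      level n a α t i j (u + 1) * iSeries n a α u ∧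
    j = jSum n a α t u + level n a α t i j u * jSeries α (u + 1) -
      level n a α t i j (u + 1) * jSeries α u := by
  induction u with
  | zero =>
    simp only [remainder, level, iSeries, jSum, jSeries]
    rw [Int.ediv_mul_cancel h]
    constructor <;> ring
  | succ u ih =>
    obtain ⟨h1, h2⟩ := ih
    rw [remainder_succ]
    have h3 := level_rec (n := n) (a := a) (α := α) (t := t) i j u
    have h4 : level n a α t i j (u + 2) = α (u + 1) * level n a α t i j (u + 1) +
      digit (iSeries n a α) t (u + 1) - level n a α t i j u := by linarith
    rw [h4]
    simp only [iSeries, jSum, jSeries]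
    constructor
    · linear_combination h1
    · linear_combination h2

/-- The point whose levels at `u` and `u + 1` are `p` and `b`. -/
def levelPoint (n a : ℕ) (α : ℕ → ℕ) (t u : ℕ) (p b : ℤ) : ℤ × ℤ :=
  (remainder (iSeries n a α) t u - p * iSeries n a α (u + 1) + b * iSeries n a α u,
    jSum n a α t u + p * jSeries α (u + 1) - b * jSeries α u)

lemma levelPoint_level {i j : ℤ} (h : (n : ℤ) ∣ i + j * a - t) (u : ℕ) :
    levelPoint n a α t u (level n a α t i j u) (level n a α t i j (u + 1)) = (i, j) := by
  obtain ⟨h1, h2⟩ := eq_level (α := α) h u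
  exact Prod.ext h1.symm h2.symm

lemma levelPoint_dvd (u : ℕ) (p b : ℤ) :
    (n : ℤ) ∣ (levelPoint n a α t u p b).1 + (levelPoint n a α t u p b).2 * a - t := by
  induction u generalizing p b with
  | zero =>
    simp only [levelPoint, remainder, iSeries, jSum, jSeries]
    exact ⟨b, by ring⟩
  | succ u ih =>
    -- The recursion run backwards: levels p, b at u + 1, u + 2 force this level at u.
    obtain ⟨c, hc⟩ := ih (α (u + 1) * p + digit (iSeries n a α) t (u + 1) - b) p
    refine ⟨c, ?_⟩
    rw [← hc]
    simp only [levelPoint, remainder_succ, iSeries, jSum, jSeries]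
    ring

/-- Cramer's rule, with determinant n from `jSeries_det`. -/
lemma level_levelPoint (hn : 0 < n) (u : ℕ) (p b : ℤ) :
    level n a α t (levelPoint n a α t u p b).1 (levelPoint n a α t u p b).2 u = p ∧
    level n a α t (levelPoint n a α t u p b).1 (levelPoint n a α t u p b).2 (u + 1) = b := by
  obtain ⟨h1, h2⟩ := eq_level (α := α) (levelPoint_dvd (n := n) (a := a) (α := α) (t := t) u p b) u
  set y := level n a α t (levelPoint n a α t u p b).1 (levelPoint n a α t u p b).2
  have hdet := jSeries_det n a α u
  have hn' : (n : ℤ) ≠ 0 := by positivity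
  simp only [levelPoint] at h1 h2
  constructor
  · refine mul_right_cancel₀ hn' ?_
    rw [← hdet]
    linear_combination -jSeries α u * h1 - iSeries n a α u * h2
  · refine mul_right_cancel₀ hn' ?_
    rw [← hdet]
    linear_combination -jSeries α (u + 1) * h1 - iSeries n a α (u + 1) * h2

/-- The invariant factor has t = 0, hence all digits zero, so the inhomogeneous term of the
recursion is counted only once. -/
lemma level_add {i j i' j' : ℤ} (h' : (n : ℤ) ∣ i' + j' * a) (u : ℕ) :
    level n a α t (i + i') (j + j') u = level n a α t i j u + level n a α 0 i' j' u := by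
  induction u using Nat.twoStepInduction with
  | zero => rfl
  | one =>
    simp only [level]
    have : i + i' + (j + j') * (a : ℤ) - t = (i + j * a - t) + (i' + j' * a) := by ring
    rw [this, Int.add_ediv_of_dvd_right h']
    simp
  | more u h1 h2 =>
    simp only [level, h1, h2, digit_zero]
    ring

/-! ### Signs of the levels and local minima -/

lemma IsHJData.level_end (D : IsHJData n a r α) (ht : t < n) {i j : ℤ}
    (h : (n : ℤ) ∣ i + j * a - t) : level n a α t i j (r + 1) = i := by
  have h1 := (eq_level (α := α) h r).1
  have h2 := D.remainder_bounds ht r le_rfl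
  rw [D.i_end, D.i_last] at h1
  rw [D.i_last] at h2
  omega

/-- At the first negative level y_{u+1} ≤ -1, `eq_level` gives i ≤ h_u - i_u < 0. -/
lemma IsHJData.level_nonneg (D : IsHJData n a r α) (ht : t < n) {i j : ℤ}
    (h : (n : ℤ) ∣ i + j * a - t) (hi : 0 ≤ i) (hj : 0 ≤ j) :
    ∀ u, u ≤ r + 1 → 0 ≤ level n a α t i j u := by
  intro u
  induction u with
  | zero => intro _; exact hj
  | succ u ih =>
    intro hu
    have h0 := ih (by omega)
    by_contra! hneg
    have h1 := (eq_level (α := α) h u).1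
    have h2 := D.remainder_bounds ht u (by omega)
    have h3 : 0 ≤ iSeries n a α (u + 1) := by
      rcases Nat.lt_or_ge u r with h | h
      · exact (D.i_pos _ h).le
      · rw [show u = r by omega, D.i_end]
    have h4 := mul_nonneg h0 h3
    nlinarith

/-- For t = 0, a zero level forces its two nonnegative neighbours to sum to zero. Two consecutive
levels then vanish, and so do both exponents. -/
lemma IsHJData.level_pos (D : IsHJData n a r α) {i j : ℤ}
    (h : (n : ℤ) ∣ i + j * a) (hi : 0 ≤ i) (hj : 0 ≤ j) (hne : i ≠ 0 ∨ j ≠ 0) (u : ℕ)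
    (h1 : 1 ≤ u) (hu : u ≤ r) : 1 ≤ level n a α 0 i j u := by
  have h' : (n : ℤ) ∣ i + j * a - (0 : ℕ) := by simpa using h
  have hnn := D.level_nonneg D.n_pos h' hi hj
  obtain ⟨w, rfl⟩ : ∃ w, u = w + 1 := ⟨u - 1, by omega⟩
  by_contra! hlt
  have h0 : level n a α 0 i j (w + 1) = 0 := by
    have := hnn (w + 1) (by omega)
    omega
  have h2 := level_rec (n := n) (a := a) (α := α) (t := 0) i j w
  rw [h0, digit_zero] at h2
  have h3 := hnn w (by omega)
  have h4 := hnn (w + 2) (by omega)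
  have h5 : level n a α 0 i j w = 0 := by linarith
  obtain ⟨h6, h7⟩ := eq_level (α := α) h' w
  rw [h0, h5, remainder_zero] at h6
  rw [h0, h5, jSum_zero] at h7
  simp at h6 h7
  tauto

/-- A convex sequence that does not decrease to the right of `u` stays above its value at `u`. -/
lemma convex_right {z : ℕ → ℤ} {c : ℤ} (hc : 0 ≤ c) {u : ℕ}
    (hz : ∀ w, u ≤ w → w + 1 ≤ r → 2 * z (w + 1) ≤ z w + z (w + 2) ∨ z (w + 1) < 0)
    (h0 : c ≤ z u) (hu : u < r → z u ≤ z (u + 1)) (hu' : u = r → 0 ≤ z (r + 1)) (hur : u ≤ r) :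
    (∀ w, u ≤ w → w ≤ r → c ≤ z w) ∧ 0 ≤ z (r + 1) := by
  have key : ∀ w, u ≤ w → w < r → c ≤ z w ∧ z w ≤ z (w + 1) := by
    intro w hw
    induction w, hw using Nat.le_induction with
    | base => intro h; exact ⟨h0, hu h⟩
    | succ w hw ih =>
      intro h
      have h1 := ih (by omega)
      have h2 := hz w hw (by omega)
      simp only [add_assoc, Nat.reduceAdd] at *
      omega
  rcases hur.eq_or_lt with h | h
  · subst h
    exact ⟨fun w hw hw' => by rwa [show w = u by omega], hu' rfl⟩
  · obtain ⟨s, rfl⟩ : ∃ s, r = s + 1 := ⟨r - 1, by omega⟩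
    have h1 := key s (by omega) (by omega)
    have h2 := hz s (by omega) (by omega)
    refine ⟨fun w hw hw' => ?_, ?_⟩
    · rcases Nat.lt_or_ge w (s + 1) with h3 | h3
      · exact (key w hw h3).1
      · rw [show w = s + 1 by omega]; omega
    · simp only [add_assoc, Nat.reduceAdd] at *
      omega

lemma convex_left {z : ℕ → ℤ} {c : ℤ} (hc : 0 ≤ c) {u : ℕ}
    (hz : ∀ w, w + 1 ≤ u → 2 * z (w + 1) ≤ z w + z (w + 2) ∨ z (w + 1) < 0)
    (h0 : c ≤ z u) (hu : 1 < u → z u ≤ z (u - 1)) (hu' : u = 1 → 0 ≤ z 0) (hur : 1 ≤ u) :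
    (∀ w, 1 ≤ w → w ≤ u → c ≤ z w) ∧ 0 ≤ z 0 := by
  have key : ∀ m, m + 1 < u → c ≤ z (u - m) ∧ z (u - m) ≤ z (u - m - 1) := by
    intro m
    induction m with
    | zero => intro h; exact ⟨h0, hu h⟩
    | succ m ih =>
      intro h
      have h1 := ih (by omega)
      have h2 := hz (u - m - 2) (by omega)
      rw [show u - m - 2 + 1 = u - (m + 1) by omega, show u - m - 2 + 2 = u - m by omega] at h2
      rw [show u - m - 1 = u - (m + 1) by omega] at h1
      rw [show u - (m + 1) - 1 = u - m - 2 by omega]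
      omega
  rcases hur.eq_or_lt with h | h
  · subst h
    exact ⟨fun w hw hw' => by rwa [show w = 1 by omega], hu' rfl⟩
  · have h1 := key (u - 2) (by omega)
    have h2 := hz 0 (by omega)
    rw [show u - (u - 2) = 2 by omega] at h1
    simp only [zero_add, Nat.reduceSub] at h1 h2
    refine ⟨fun w hw hw' => ?_, by omega⟩
    rcases Nat.lt_or_ge 1 w with h3 | h3
    · have := (key (u - w) (by omega)).1
      rwa [show u - (u - w) = w by omega] at this
    · rw [show w = 1 by omega]; omega

/-- A monomial whose levels at `1, …, r` have a local minimum at `u`. -/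
lemma IsHJData.of_local_min (D : IsHJData n a r α) (ht : t < n) {i j : ℤ}
    (h : (n : ℤ) ∣ i + j * a - t) {u : ℕ} (h1 : 1 ≤ u) (hu : u ≤ r) {c : ℤ} (hc : 0 ≤ c)
    (h0 : c ≤ level n a α t i j u)
    (hr : u < r → level n a α t i j u ≤ level n a α t i j (u + 1))
    (hr' : u = r → 0 ≤ level n a α t i j (r + 1))
    (hl : 1 < u → level n a α t i j u ≤ level n a α t i j (u - 1))
    (hl' : u = 1 → 0 ≤ level n a α t i j 0) :
    0 ≤ i ∧ 0 ≤ j ∧ ∀ w, 1 ≤ w → w ≤ r → c ≤ level n a α t i j w := by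
  -- Convexity comes from α y ≥ 2y, which needs y ≥ 0. The negative alternative is excluded step by
  -- step when moving away from u.
  have hz : ∀ w, w + 1 ≤ r → 2 * level n a α t i j (w + 1) ≤
      level n a α t i j w + level n a α t i j (w + 2) ∨ level n a α t i j (w + 1) < 0 := by
    intro w hw
    rw [level_rec]
    have h2 : (2 : ℤ) ≤ α (w + 1) := by exact_mod_cast D.two_le (w + 1) (by omega) hw
    have h3 := D.digit_nonneg ht (w + 1) hw
    rcases lt_or_ge (level n a α t i j (w + 1)) 0 with h4 | h4
    · exact Or.inr h4
    · left; nlinarith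
  obtain ⟨hR, hR'⟩ := convex_right hc (fun w _ => hz w) h0 hr hr' hu
  obtain ⟨hL, hL'⟩ := convex_left hc (fun w hw => hz w (by omega)) h0 hl hl' h1
  rw [D.level_end ht h] at hR'
  refine ⟨hR', hL', fun w hw hw' => ?_⟩
  rcases le_total u w with h5 | h5
  · exact hR w h5 hw'
  · exact hL w hw h5

/-- Choosing the leftmost minimum ensures that each monomial is counted once in
`IsHJData.exists_layer`. -/
lemma exists_first_min (y : ℕ → ℤ) (hr : 1 ≤ r) : ∃ u, 1 ≤ u ∧ u ≤ r ∧
    (∀ w, 1 ≤ w → w ≤ r → y u ≤ y w) ∧ ∀ w, 1 ≤ w → w < u → y u < y w := by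
  obtain ⟨u₀, hu₀, hmin⟩ := (Finset.Icc 1 r).exists_min_image y ⟨1, Finset.mem_Icc.2 ⟨le_rfl, hr⟩⟩
  have hex : ∃ u, (1 ≤ u ∧ u ≤ r) ∧ ∀ w, 1 ≤ w → w ≤ r → y u ≤ y w :=
    ⟨u₀, Finset.mem_Icc.1 hu₀, fun w h h' => hmin w (Finset.mem_Icc.2 ⟨h, h'⟩)⟩
  classical
  have hs := Nat.find_spec hex
  refine ⟨Nat.find hex, hs.1.1, hs.1.2, hs.2, fun w hw hw' => ?_⟩
  have hnot := Nat.find_min hex hw'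
  refine lt_of_le_of_ne (hs.2 w hw (by omega)) fun heq => hnot ⟨⟨hw, by omega⟩, ?_⟩
  rw [← heq]
  exact hs.2

/-- A monomial of `M_t` all of whose levels are at least `k + 1` is the product of a nonconstant
invariant monomial and a monomial of `M_t` all of whose levels are at least `k`. -/
lemma IsHJData.exists_sub (D : IsHJData n a r α) (ht : t < n) {i j : ℤ}
    (h : (n : ℤ) ∣ i + j * a - t) (hi : 0 ≤ i) (hj : 0 ≤ j) {k : ℤ} (hk : 0 ≤ k)
    (hlev : ∀ u, 1 ≤ u → u ≤ r → k + 1 ≤ level n a α t i j u) :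
    ∃ i' j' : ℤ, 0 ≤ i' ∧ 0 ≤ j' ∧ i' ≤ n ∧ j' ≤ n ∧ (i' ≠ 0 ∨ j' ≠ 0) ∧ (n : ℤ) ∣ i' + j' * a ∧
      0 ≤ i - i' ∧ 0 ≤ j - j' ∧
      ∀ u, 1 ≤ u → u ≤ r → k ≤ level n a α t (i - i') (j - j') u := by
  obtain ⟨u, h1, hu, hmin, -⟩ := exists_first_min (level n a α t i j) D.one_le
  obtain ⟨s, rfl⟩ : ∃ s, u = s + 1 := ⟨u - 1, by omega⟩
  have hnn := D.level_nonneg ht h hi hj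
  have hrec := level_rec (n := n) (a := a) (α := α) (t := t) i j s
  have hα : (2 : ℤ) ≤ α (s + 1) := by exact_mod_cast D.two_le _ h1 hu
  have hd := D.digit_nonneg ht (s + 1) hu
  have hlevu := hlev _ h1 hu
  set y := level n a α t i j with hy
  -- The numbers l and ρ record whether the left and right neighbours of the minimum are among the
  -- levels 1, …, r. At the ends 0 and r + 1, which are exponents, only nonnegativity is required.
  obtain ⟨l, hl⟩ : ∃ l : ℤ, l = if s = 0 then 0 else 1 := ⟨_, rfl⟩
  obtain ⟨ρ, hρ⟩ : ∃ ρ : ℤ, ρ = if s + 1 = r then 0 else 1 := ⟨_, rfl⟩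
  have hyl : l * y (s + 1) ≤ y s := by
    rw [hl]
    split_ifs with hs
    · rw [zero_mul]; exact hnn s (by omega)
    · rw [one_mul]; exact hmin s (by omega) (by omega)
  have hyr : ρ * y (s + 1) ≤ y (s + 2) := by
    rw [hρ]
    split_ifs with hs
    · rw [zero_mul]; exact hnn _ (by omega)
    · rw [one_mul]; exact hmin _ (by omega) (by omega)
  have hl01 : l = 0 ∨ l = 1 := by rw [hl]; split_ifs <;> simp
  have hρ01 : ρ = 0 ∨ ρ = 1 := by rw [hρ]; split_ifs <;> simp
  -- The invariant factor will have levels α - b, 1, b around the minimum. The first two conditions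
  -- make 1 a local minimum for it, the last two keep the local minimum for the quotient. The
  -- witness is the larger lower bound for b; compatibility with the upper bounds comes down to α ≥
  -- 2 and (α - l - ρ)(y - 1) + d ≥ 0, where y ≥ 1 is the minimal level.
  obtain ⟨b, hb1, hb2, hb3, hb4⟩ : ∃ b : ℤ, ρ ≤ b ∧ l ≤ α (s + 1) - b ∧
      ρ * (y (s + 1) - 1) ≤ y (s + 2) - b ∧ l * (y (s + 1) - 1) ≤ y s - (α (s + 1) - b) := by
    refine ⟨max ρ (α (s + 1) - l - (y s - l * y (s + 1))), le_max_left _ _, ?_, ?_, ?_⟩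
    · have : max ρ (α (s + 1) - l - (y s - l * y (s + 1))) ≤ α (s + 1) - l := by
        apply max_le
        · rcases hl01 with h | h <;> rcases hρ01 with h' | h' <;> rw [h, h'] <;> linarith
        · linarith
      linarith
    · have : max ρ (α (s + 1) - l - (y s - l * y (s + 1))) ≤
          y (s + 2) - ρ * (y (s + 1) - 1) := by
        apply max_le
        · linarith
        · have h5 : 0 ≤ (α (s + 1) - l - ρ) * (y (s + 1) - 1) := by
            apply mul_nonneg
            · rcases hl01 with h | h <;> rcases hρ01 with h' | h' <;> rw [h, h'] <;> linarith
            · linarith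
          linarith
      linarith
    · have := le_max_right ρ (α (s + 1) - l - (y s - l * y (s + 1)))
      linarith
  obtain ⟨⟨i', j'⟩, hv⟩ : ∃ v, v = levelPoint n a α 0 (s + 1) 1 b := ⟨_, rfl⟩
  have hdvd0 : (n : ℤ) ∣ i' + j' * a - (0 : ℕ) := by
    have := levelPoint_dvd (n := n) (a := a) (α := α) (t := 0) (s + 1) 1 b
    rwa [← hv] at this
  have hdvd : (n : ℤ) ∣ i' + j' * a := by simpa using hdvd0
  obtain ⟨hx1, hx2⟩ := level_levelPoint (a := a) (α := α) (t := 0) D.n_pos (s + 1) 1 b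
  rw [← hv] at hx1 hx2
  have hx0 := level_rec (n := n) (a := a) (α := α) (t := 0) i' j' s
  simp only [add_assoc, Nat.reduceAdd] at hx1 hx2 hrec
  rw [digit_zero, hx1, hx2] at hx0
  have hx0' : level n a α 0 i' j' s = α (s + 1) - b := by linarith
  obtain ⟨hi', hj', -⟩ := D.of_local_min D.n_pos hdvd0 h1 hu (c := 0) le_rfl
    (by simp only [hx1]; norm_num)
    (by intro hs
        simp only [add_assoc, Nat.reduceAdd, hx1, hx2]
        rwa [hρ, if_neg (by omega)] at hb1)
    (by intro hs
        rw [← hs]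
        simp only [add_assoc, Nat.reduceAdd, hx2]
        rwa [hρ, if_pos hs] at hb1)
    (by intro hs
        simp only [Nat.add_sub_cancel, hx1, hx0']
        rwa [hl, if_neg (by omega)] at hb2)
    (by intro hs
        obtain rfl : s = 0 := by omega
        rw [hx0']
        rwa [hl, if_pos rfl] at hb2)
  -- Level 1 at the minimum makes this pairing equal to the determinant n. It bounds both exponents
  -- by n, so finitely many invariant factors suffice, and shows that the factor is not constant.
  have hbound : i' * jSeries α (s + 1) + j' * iSeries n a α (s + 1) = n := by
    have h1 := (eq_level (α := α) hdvd0 (s + 1)).1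
    have h2 := (eq_level (α := α) hdvd0 (s + 1)).2
    simp only [hx1, remainder_zero, jSum_zero] at h1 h2
    rw [← jSeries_det n a α (s + 1)]
    linear_combination jSeries α (s + 1) * h1 + iSeries n a α (s + 1) * h2
  have hJ := D.jSeries_pos (s + 1) h1 hu
  have hI := D.i_pos (s + 1) hu
  have hdvd' : (n : ℤ) ∣ (i - i') + (j - j') * a - t := by
    have e : (i - i') + (j - j') * a - t = (i + j * a - t) - (i' + j' * a) := by ring
    rw [e]
    exact dvd_sub h hdvd
  have hz : ∀ w, level n a α t (i - i') (j - j') w = y w - level n a α 0 i' j' w := by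
    intro w
    have := level_add (α := α) (t := t) (i := i - i') (j := j - j') hdvd w
    rw [sub_add_cancel, sub_add_cancel] at this
    rw [hy, this]
    ring
  obtain ⟨hi2, hj2, hall⟩ := D.of_local_min ht hdvd' h1 hu hk
    (by rw [hz, hx1]; linarith)
    (by intro hs
        simp only [add_assoc, Nat.reduceAdd, hz, hx1, hx2]
        rwa [hρ, if_neg (by omega), one_mul] at hb3)
    (by intro hs
        rw [← hs]
        simp only [add_assoc, Nat.reduceAdd, hz, hx2]
        rwa [hρ, if_pos hs, zero_mul] at hb3)
    (by intro hs
        simp only [Nat.add_sub_cancel, hz, hx1, hx0']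
        rwa [hl, if_neg (by omega), one_mul] at hb4)
    (by intro hs
        obtain rfl : s = 0 := by omega
        rw [hz, hx0']
        rwa [hl, if_pos rfl, zero_mul] at hb4)
  refine ⟨i', j', hi', hj', ?_, ?_, ?_, hdvd, hi2, hj2, hall⟩
  · nlinarith [mul_nonneg hj' hI.le]
  · nlinarith [mul_nonneg hi' hJ.le]
  · by_contra! hcon
    rw [hcon.1, hcon.2] at hbound
    have := D.n_pos
    omega

/-- The number of monomials of `M_t` whose smallest level is `p`. -/
lemma IsHJData.exists_layer (D : IsHJData n a r α) (ht : t < n) (p : ℕ) :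
    ∃ L : Finset (ℤ × ℤ), (L.card : ℤ) = (∑ u ∈ Finset.Icc 1 r, (α u : ℤ) - 2 * ((r : ℤ) - 1)) * p +
      ∑ u ∈ Finset.Icc 1 r, digit (iSeries n a α) t u + 1 ∧
      ∀ i j : ℤ, (i, j) ∈ L ↔ 0 ≤ i ∧ 0 ≤ j ∧ (n : ℤ) ∣ i + j * a - t ∧
        (∀ u, 1 ≤ u → u ≤ r → (p : ℤ) ≤ level n a α t i j u) ∧
        ∃ u, 1 ≤ u ∧ u ≤ r ∧ level n a α t i j u = p := by
  classical
  -- A monomial is indexed by the leftmost u with level p and by its level b at u + 1. The condition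
  -- on the right neighbour is b ≥ p, or b ≥ 0 if u = r. The left neighbour αp + d - b must be at
  -- least p + 1 because u is leftmost, or at least 0 if u = 1; this gives the exclusive bound `hi`.
  let lo : ℕ → ℤ := fun u => if u = r then 0 else p
  let hi : ℕ → ℤ := fun u => α u * p + digit (iSeries n a α) t u + (if u = 1 then 1 else -(p : ℤ))
  let T : Finset (Σ _ : ℕ, ℤ) := (Finset.Icc 1 r).sigma fun u => Finset.Ico (lo u) (hi u)
  let f : (Σ _ : ℕ, ℤ) → ℤ × ℤ := fun q => levelPoint n a α t q.1 p q.2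
  have hmemT : ∀ u b, (⟨u, b⟩ : Σ _ : ℕ, ℤ) ∈ T ↔ (1 ≤ u ∧ u ≤ r) ∧ lo u ≤ b ∧ b < hi u := by
    intro u b
    simp only [T, Finset.mem_sigma, Finset.mem_Icc, Finset.mem_Ico]
  -- the levels of a point of the family
  have hprop : ∀ u b, (⟨u, b⟩ : Σ _ : ℕ, ℤ) ∈ T → ∀ i j, f ⟨u, b⟩ = (i, j) →
      0 ≤ i ∧ 0 ≤ j ∧ (n : ℤ) ∣ i + j * a - t ∧
        (∀ w, 1 ≤ w → w ≤ r → (p : ℤ) ≤ level n a α t i j w) ∧ level n a α t i j u = p ∧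
        level n a α t i j (u + 1) = b ∧ (1 < u → (p : ℤ) < level n a α t i j (u - 1)) := by
    intro u b hub i j hij
    obtain ⟨⟨h1, hu⟩, hb1, hb2⟩ := (hmemT u b).1 hub
    have hdvd := levelPoint_dvd (n := n) (a := a) (α := α) (t := t) u p b
    obtain ⟨hy1, hy2⟩ := level_levelPoint (a := a) (α := α) (t := t) D.n_pos u p b
    simp only [f] at hij
    rw [hij] at hdvd hy1 hy2
    obtain ⟨s, rfl⟩ : ∃ s, u = s + 1 := ⟨u - 1, by omega⟩
    have hrec := level_rec (n := n) (a := a) (α := α) (t := t) i j s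
    simp only [add_assoc, Nat.reduceAdd] at hy1 hy2
    rw [hy1, hy2] at hrec
    simp only [lo, hi] at hb1 hb2
    have hl : 1 < s + 1 → (p : ℤ) < level n a α t i j s := by
      intro hs
      rw [if_neg (by omega)] at hb2
      linarith
    obtain ⟨hi0, hj0, hall⟩ := D.of_local_min ht hdvd h1 hu (c := p) (by positivity) hy1.ge
      (by intro hs
          simp only [add_assoc, Nat.reduceAdd, hy1, hy2]
          rwa [if_neg (by omega)] at hb1)
      (by intro hs
          rw [← hs]
          simp only [add_assoc, Nat.reduceAdd, hy2]
          rwa [if_pos hs] at hb1)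
      (by intro hs
          rw [hy1]
          exact (hl hs).le)
      (by intro hs
          obtain rfl : s = 0 := by omega
          rw [if_pos rfl] at hb2
          linarith)
    exact ⟨hi0, hj0, hdvd, hall, hy1, hy2, hl⟩
  have hinj : Set.InjOn f T := by
    rintro ⟨u, b⟩ hub ⟨u', b'⟩ hub' heq
    obtain ⟨⟨i, j⟩, hij⟩ : ∃ v, f ⟨u, b⟩ = v := ⟨_, rfl⟩
    have h := hprop u b hub i j hij
    have h' := hprop u' b' hub' i j (heq ▸ hij)
    have hu := ((hmemT u b).1 hub).1
    have hu' := ((hmemT u' b').1 hub').1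
    have huu : u = u' := by
      -- both are the first place where the level `p` is attained
      by_contra hne
      have aux : ∀ v v' : ℕ, 1 ≤ v → v < v' → v' ≤ r → level n a α t i j v = p →
          level n a α t i j v' = p → (p : ℤ) < level n a α t i j (v' - 1) → False := by
        intro v v' h1 hlt hr hv hv' hgt
        -- By convexity the levels do not decrease when moving left from v', so they stay above p
        -- and cannot return to p at v.
        have hdec : ∀ m, v + m + 1 ≤ v' → (p : ℤ) < level n a α t i j (v' - 1 - m) := by
          intro m
          have : ∀ m, v + m + 1 ≤ v' → (p : ℤ) < level n a α t i j (v' - 1 - m) ∧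
              level n a α t i j (v' - m) ≤ level n a α t i j (v' - 1 - m) := by
            intro m
            induction m with
            | zero => intro _; exact ⟨hgt, by simp only [Nat.sub_zero]; rw [hv']; exact hgt.le⟩
            | succ m ih =>
              intro hm
              obtain ⟨h2, h3⟩ := ih (by omega)
              have hrec := level_rec (n := n) (a := a) (α := α) (t := t) i j (v' - 1 - (m + 1))
              rw [show v' - 1 - (m + 1) + 2 = v' - m by omega,
                show v' - 1 - (m + 1) + 1 = v' - 1 - m by omega] at hrec
              have hα : (2 : ℤ) ≤ α (v' - 1 - m) := by
                exact_mod_cast D.two_le _ (by omega) (by omega)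
              have hd := D.digit_nonneg ht (v' - 1 - m) (by omega)
              rw [show v' - (m + 1) = v' - 1 - m by omega]
              have : level n a α t i j (v' - 1 - m) ≤ level n a α t i j (v' - 1 - (m + 1)) := by
                nlinarith
              exact ⟨by linarith, this⟩
          exact fun hm => (this m hm).1
        have := hdec (v' - 1 - v) (by omega)
        rw [show v' - 1 - (v' - 1 - v) = v by omega, hv] at this
        exact lt_irrefl _ this
      rcases Nat.lt_or_gt_of_ne hne with hlt | hlt
      · exact aux u u' hu.1 hlt hu'.2 h.2.2.2.2.1 h'.2.2.2.2.1 (h'.2.2.2.2.2.2 (by omega))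
      · exact aux u' u hu'.1 hlt hu.2 h'.2.2.2.2.1 h.2.2.2.2.1 (h.2.2.2.2.2.2 (by omega))
    subst huu
    have : b = b' := h.2.2.2.2.2.1.symm.trans h'.2.2.2.2.2.1
    rw [this]
  refine ⟨T.image f, ?_, ?_⟩
  · rw [Finset.card_image_of_injOn hinj]
    simp only [T, Finset.card_sigma, Int.card_Ico]
    -- No truncation occurs in `toNat`, because α_u ≥ 2 gives αp ≥ 2p. The corrections at u = 1 and
    -- u = r account for the 2(r - 1) and the final + 1.
    have hterm : ∀ u ∈ Finset.Icc 1 r, (((hi u - lo u).toNat : ℕ) : ℤ) =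
        (α u : ℤ) * p + digit (iSeries n a α) t u +
          ((if u = 1 then ((p : ℤ) + 1) else 0) + (if u = r then (p : ℤ) else 0) - 2 * p) := by
      intro u hu
      rw [Finset.mem_Icc] at hu
      have hα : (2 : ℤ) ≤ α u := by exact_mod_cast D.two_le _ hu.1 hu.2
      have hd := D.digit_nonneg ht u hu.2
      have hm : 2 * (p : ℤ) ≤ α u * p := by nlinarith [Int.natCast_nonneg p]
      rw [Int.toNat_of_nonneg]
      · simp only [hi, lo]
        split_ifs <;> ring
      · simp only [hi, lo]
        split_ifs <;> linarith [Int.natCast_nonneg p]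
    push_cast
    rw [Finset.sum_congr rfl hterm]
    simp only [Finset.sum_add_distrib, Finset.sum_sub_distrib, Finset.sum_ite_eq',
      Finset.sum_const, Nat.card_Icc, Finset.mem_Icc, D.one_le, le_refl, and_self, if_true,
      ← Finset.sum_mul]
    simp only [Nat.add_sub_cancel, nsmul_eq_mul]
    ring
  · intro i j
    rw [Finset.mem_image]
    constructor
    · rintro ⟨⟨u, b⟩, hub, hij⟩
      obtain ⟨h1, h2, h3, h4, h5, -⟩ := hprop u b hub i j hij
      have hu := ((hmemT u b).1 hub).1
      exact ⟨h1, h2, h3, h4, u, hu.1, hu.2, h5⟩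
    · rintro ⟨hi0, hj0, hdvd, hall, w, hw1, hw, hwp⟩
      obtain ⟨u, h1, hu, hmin, hfirst⟩ := exists_first_min (level n a α t i j) D.one_le
      have hup : level n a α t i j u = p :=
        le_antisymm ((hmin w hw1 hw).trans hwp.le) (hall u h1 hu)
      refine ⟨⟨u, level n a α t i j (u + 1)⟩, (hmemT _ _).2 ⟨⟨h1, hu⟩, ?_, ?_⟩, ?_⟩
      · simp only [lo]
        split_ifs with hr
        · exact D.level_nonneg ht hdvd hi0 hj0 _ (by omega)
        · exact hall _ (by omega) (by omega)
      · obtain ⟨s, rfl⟩ : ∃ s, u = s + 1 := ⟨u - 1, by omega⟩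
        have hrec := level_rec (n := n) (a := a) (α := α) (t := t) i j s
        rw [hup] at hrec
        simp only [hi, add_assoc, Nat.reduceAdd]
        split_ifs with hs
        · have := D.level_nonneg ht hdvd hi0 hj0 s (by omega)
          linarith
        · have := hfirst s (by omega) (by omega)
          rw [hup] at this
          linarith
      · simp only [f]
        rw [← hup]
        exact levelPoint_level hdvd u

end Level

end CyclicQuotient

namespace CyclicQuotient

open MvPowerSeries

/-! ### Lengths and numbers of generators -/

section General

variable {R : Type*} [CommRing R]

/-- Additivity of length on 0 → B/A → M/A → M/B → 0, with φ identifying B/A with N. -/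
lemma length_quotient_eq_add {M N : Type*} [AddCommGroup M] [Module R M] [AddCommGroup N]
    [Module R N] {A B : Submodule R M} (h : A ≤ B) (φ : B →ₗ[R] N) (hφ : Function.Surjective φ)
    (hker : LinearMap.ker φ = A.comap B.subtype) :
    Module.length R (M ⧸ A) = Module.length R N + Module.length R (M ⧸ B) := by
  let f : (B ⧸ A.comap B.subtype) →ₗ[R] M ⧸ A := Submodule.mapQ _ A B.subtype le_rfl
  have hf : Function.Injective f := by
    rw [← LinearMap.ker_eq_bot, Submodule.ker_mapQ]
    exact Submodule.mkQ_map_self _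
  have hg : Function.Surjective (Submodule.factor h) := Submodule.factor_surjective h
  have hfg : Function.Exact f (Submodule.factor h) := by
    intro x
    obtain ⟨x, rfl⟩ := Submodule.mkQ_surjective _ x
    change (Submodule.Quotient.mk x : M ⧸ B) = 0 ↔ _
    rw [Submodule.Quotient.mk_eq_zero]
    constructor
    · intro hx
      exact ⟨Submodule.Quotient.mk ⟨x, hx⟩, rfl⟩
    · rintro ⟨y, hy⟩
      obtain ⟨y, rfl⟩ := Submodule.mkQ_surjective _ y
      have : (Submodule.Quotient.mk (y : M) : M ⧸ A) = Submodule.Quotient.mk x := hy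
      rw [Submodule.Quotient.eq] at this
      have := B.sub_mem y.2 (h this)
      simpa using this
  rw [Module.length_eq_add_of_exact f _ hf hg hfg]
  congr 1
  refine LinearEquiv.length_eq ?_
  rw [← hker]
  exact φ.quotKerEquivOfSurjective hφ

variable [IsLocalRing R]

lemma length_pi_residue (ι : Type*) [Fintype ι] :
    Module.length R (ι → R ⧸ IsLocalRing.maximalIdeal R) = Fintype.card ι := by
  have : IsSimpleModule R (R ⧸ IsLocalRing.maximalIdeal R) :=
    isSimpleModule_iff_isCoatom.2 (IsLocalRing.maximalIdeal.isMaximal R).out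
  rw [Module.length_pi, Module.length_eq_one]
  simp

lemma length_quotient_eq_card_add {M ι : Type*} [AddCommGroup M] [Module R M] [Fintype ι]
    {A B : Submodule R M} (h : A ≤ B) (φ : B →ₗ[R] (ι → R ⧸ IsLocalRing.maximalIdeal R))
    (hφ : Function.Surjective φ) (hker : LinearMap.ker φ = A.comap B.subtype) :
    Module.length R (M ⧸ A) = Fintype.card ι + Module.length R (M ⧸ B) := by
  rw [length_quotient_eq_add h φ hφ hker, length_pi_residue]

lemma mu_eq_of_length {M : Type*} [AddCommGroup M] [Module R M] {c : ℕ}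
    (h : Module.length R (M ⧸ (IsLocalRing.maximalIdeal R • (⊤ : Submodule R M))) = c) :
    mu R M = c := by
  let _ : Field (R ⧸ IsLocalRing.maximalIdeal R) := Ideal.Quotient.field _
  rw [Module.length_eq_of_surjective (R := R ⧸ IsLocalRing.maximalIdeal R)
    Ideal.Quotient.mk_surjective, Module.length_eq_rank, Cardinal.toENat_eq_natCast] at h
  exact Module.finrank_eq_of_rank_eq h

lemma tendsto_hilbertSamuelRatio {M : Type*} [AddCommGroup M] [Module R M] (hdim : dim R = 2)
    {e : ℝ} {b : ℝ} (l : ℕ → ℕ) (hl : ∀ m, Module.length R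
      (M ⧸ ((IsLocalRing.maximalIdeal R) ^ m • (⊤ : Submodule R M))) = l m)
    (hl2 : ∀ m, (l m : ℝ) = e * (m * (m - 1) / 2) + b * m) :
    Tendsto (hilbertSamuelRatio R M) atTop (𝓝 e) := by
  -- For m > 0 the ratio 2! · l(m)/m² equals this expression.
  have h0 : Tendsto (fun m : ℕ => e + (2 * b - e) * ((m : ℝ))⁻¹) atTop (𝓝 (e + (2 * b - e) * 0)) :=
    (tendsto_inv_atTop_nhds_zero_nat.const_mul _).const_add _
  rw [mul_zero, add_zero] at h0
  refine h0.congr' ?_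
  filter_upwards [eventually_gt_atTop 0] with m hm
  have hm' : (m : ℝ) ≠ 0 := by positivity
  rw [hilbertSamuelRatio, hdim, hl, ENat.toNat_natCast, hl2]
  simp only [Nat.factorial]
  push_cast
  field_simp
  ring

end General

/-! ### Monomials and supports -/

/-- The exponent vector of `x ^ i y ^ j`. -/
noncomputable def expo (i j : ℕ) : Fin 2 →₀ ℕ := Finsupp.single 0 i + Finsupp.single 1 j

@[simp] lemma expo_zero (i j : ℕ) : expo i j 0 = i := by simp [expo]

@[simp] lemma expo_one (i j : ℕ) : expo i j 1 = j := by simp [expo]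

lemma expo_eta (v : Fin 2 →₀ ℕ) : expo (v 0) (v 1) = v := by
  ext s
  fin_cases s <;> simp

lemma le_iff_fin_two (v w : Fin 2 →₀ ℕ) : v ≤ w ↔ v 0 ≤ w 0 ∧ v 1 ≤ w 1 := by
  constructor
  · exact fun h => ⟨h 0, h 1⟩
  · rintro ⟨h0, h1⟩ s
    fin_cases s
    · exact h0
    · exact h1

lemma ne_zero_iff_fin_two (v : Fin 2 →₀ ℕ) : v ≠ 0 ↔ v 0 ≠ 0 ∨ v 1 ≠ 0 := by
  rw [Ne, ← not_and_or, not_iff_not]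
  constructor
  · rintro rfl; simp
  · rintro ⟨h0, h1⟩
    rw [← expo_eta v, h0, h1]
    simp [expo]

/-- The monomial `x ^ i y ^ j` lies in `M_t`. -/
def HasWeight (n a t : ℕ) (v : Fin 2 →₀ ℕ) : Prop :=
  (n : ℤ) ∣ (v 0 : ℤ) + v 1 * a - t

lemma hasWeight_add_iff {n a t : ℕ} {v w : Fin 2 →₀ ℕ} : HasWeight n a t (v + w) ↔
    (n : ℤ) ∣ ((v 0 : ℤ) + v 1 * a - (0 : ℕ)) + ((w 0 : ℤ) + w 1 * a - t) := by
  have : (((v + w) 0 : ℕ) : ℤ) + ((v + w) 1 : ℕ) * a - t =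
      ((v 0 : ℤ) + v 1 * a - (0 : ℕ)) + ((w 0 : ℤ) + w 1 * a - t) := by
    simp only [Finsupp.add_apply]
    push_cast
    ring
  rw [HasWeight, this]

lemma HasWeight.add_iff {n a t : ℕ} {v w : Fin 2 →₀ ℕ} (hw : HasWeight n a t w) :
    HasWeight n a t (v + w) ↔ HasWeight n a 0 v := by
  rw [hasWeight_add_iff]
  exact (Int.dvd_add_left hw)

lemma HasWeight.add_iff' {n a t : ℕ} {v w : Fin 2 →₀ ℕ} (hv : HasWeight n a 0 v) :
    HasWeight n a t (v + w) ↔ HasWeight n a t w := by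
  rw [hasWeight_add_iff]
  exact (Int.dvd_add_right hv)

section Series

variable {k : Type*} [Field k]

/-- A power series all of whose monomials are divisible by a monomial in a finite set `G` is a
combination of the elements of `G`. -/
lemma exists_decomposition (f : MvPowerSeries (Fin 2) k) (G : Finset (Fin 2 →₀ ℕ))
    (Q : (Fin 2 →₀ ℕ) → (Fin 2 →₀ ℕ) → Prop)
    (hQ : ∀ v, coeff v f ≠ 0 → ∃ w ∈ G, w ≤ v ∧ Q w (v - w)) :
    ∃ F : (Fin 2 →₀ ℕ) → MvPowerSeries (Fin 2) k, f = ∑ w ∈ G, monomial w 1 * F w ∧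
      ∀ w ∈ G, ∀ u, coeff u (F w) ≠ 0 → Q w u ∧ coeff (u + w) f ≠ 0 := by
  classical
  choose! g hg using hQ
  -- Each monomial v of f is assigned to a single divisor g v, so the pieces have disjoint supports
  -- and no coefficient is counted twice.
  let F : (Fin 2 →₀ ℕ) → MvPowerSeries (Fin 2) k :=
    fun w u => if g (u + w) = w then coeff (u + w) f else 0
  have hF : ∀ w u, coeff u (F w) = if g (u + w) = w then coeff (u + w) f else 0 := fun _ _ => rfl
  refine ⟨F, ?_, ?_⟩
  · ext v
    rw [map_sum]
    by_cases hv : coeff v f = 0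
    · rw [hv, Finset.sum_eq_zero]
      intro w _
      rw [coeff_monomial_mul]
      split_ifs with hw
      · rw [hF, tsub_add_cancel_of_le hw, hv]
        simp
      · rfl
    · obtain ⟨h1, h2, -⟩ := hg v hv
      rw [Finset.sum_eq_single_of_mem _ h1]
      · rw [coeff_monomial_mul, if_pos h2, hF, tsub_add_cancel_of_le h2, if_pos rfl,
          one_mul]
      · intro w _ hw
        rw [coeff_monomial_mul]
        split_ifs with h
        · rw [hF, tsub_add_cancel_of_le h, if_neg (Ne.symm hw), mul_zero]
        · rfl
  · intro w _ u hu
    rw [hF] at hu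
    split_ifs at hu with h
    · have := (hg _ hu).2.2
      rw [h, add_tsub_cancel_right] at this
      exact ⟨this, hu⟩
    · exact absurd rfl hu

lemma exists_of_coeff_mul_ne_zero {f g : MvPowerSeries (Fin 2) k} {v : Fin 2 →₀ ℕ}
    (h : coeff v (f * g) ≠ 0) : ∃ p q, p + q = v ∧ coeff p f ≠ 0 ∧ coeff q g ≠ 0 := by
  rw [coeff_mul] at h
  obtain ⟨⟨p, q⟩, hpq, hne⟩ := Finset.exists_ne_zero_of_sum_ne_zero h
  exact ⟨p, q, Finset.HasAntidiagonal.mem_antidiagonal.1 hpq, left_ne_zero_of_mul hne, right_ne_zero_of_mul hne⟩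

variable {n a r t : ℕ} {α : ℕ → ℕ} {ζ : k}

/-! ### Weights of monomials and membership in M_t, R and 𝔪 -/

lemma coeff_sigma (ζ : k) (a : ℕ) (f : MvPowerSeries (Fin 2) k) (v : Fin 2 →₀ ℕ) :
    coeff v (sigma ζ a f) = ζ ^ (v 0 + v 1 * a) * coeff v f := by
  rw [sigma, rescaleAlgHom_apply, coeff_rescale, Finsupp.prod_fintype _ _ (by simp)]
  simp only [Fin.prod_univ_two, Matrix.cons_val_zero, Matrix.cons_val_one]
  rw [← pow_mul, ← pow_add, mul_comm a]

lemma pow_weight_eq_iff (hn : 0 < n) (hζ : IsPrimitiveRoot ζ n) (t : ℕ) (v : Fin 2 →₀ ℕ) :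
    ζ ^ (v 0 + v 1 * a) = ζ ^ t ↔ HasWeight n a t v := by
  have h0 : ζ ≠ 0 := hζ.ne_zero hn.ne'
  rw [HasWeight, ← hζ.zpow_eq_one_iff_dvd, zpow_sub₀ h0, div_eq_one_iff_eq (by simp [h0])]
  norm_cast

lemma mem_M_iff (hn : 0 < n) (hζ : IsPrimitiveRoot ζ n) (t : ℕ) (f : MvPowerSeries (Fin 2) k) :
    f ∈ M ζ a t ↔ ∀ v, coeff v f ≠ 0 → HasWeight n a t v := by
  change sigma ζ a f = ζ ^ t • f ↔ _
  constructor
  · intro h v hv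
    rw [← pow_weight_eq_iff hn hζ]
    have := congrArg (coeff v) h
    rw [coeff_sigma, coeff_smul] at this
    exact mul_right_cancel₀ hv this
  · intro h
    ext v
    rw [coeff_sigma, coeff_smul]
    by_cases hv : coeff v f = 0
    · rw [hv, mul_zero, mul_zero]
    · rw [(pow_weight_eq_iff hn hζ t v).2 (h v hv)]

lemma mem_invariantRing_iff (hn : 0 < n) (hζ : IsPrimitiveRoot ζ n)
    (f : MvPowerSeries (Fin 2) k) :
    f ∈ invariantRing ζ a ↔ ∀ v, coeff v f ≠ 0 → HasWeight n a 0 v := by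
  rw [← mem_M_iff hn hζ]
  change sigma ζ a f = f ↔ sigma ζ a f = ζ ^ 0 • f
  rw [pow_zero, one_smul]

lemma monomial_mem_M (hn : 0 < n) (hζ : IsPrimitiveRoot ζ n) {v : Fin 2 →₀ ℕ}
    (hv : HasWeight n a t v) (c : k) : monomial v c ∈ M ζ a t := by
  classical
  rw [mem_M_iff hn hζ]
  intro w hw
  rw [coeff_monomial] at hw
  split_ifs at hw with h
  · rwa [h]
  · exact absurd rfl hw

lemma monomial_mem_invariantRing (hn : 0 < n) (hζ : IsPrimitiveRoot ζ n) {v : Fin 2 →₀ ℕ}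
    (hv : HasWeight n a 0 v) (c : k) : monomial v c ∈ invariantRing ζ a := by
  rw [mem_invariantRing_iff hn hζ, ← mem_M_iff hn hζ]
  exact monomial_mem_M hn hζ hv c

/-- An invariant with nonzero constant term has an inverse in k[[x, y]]; σ fixes it by uniqueness of
inverses. -/
lemma mem_maximalIdeal_iff (f : invariantRing ζ a) :
    f ∈ IsLocalRing.maximalIdeal (invariantRing ζ a) ↔
      coeff 0 (f : MvPowerSeries (Fin 2) k) = 0 := by
  rw [IsLocalRing.mem_maximalIdeal, mem_nonunits_iff, not_iff_comm]
  constructor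
  · intro h
    have hu : IsUnit (f : MvPowerSeries (Fin 2) k) := by
      rw [MvPowerSeries.isUnit_iff_constantCoeff, ← coeff_zero_eq_constantCoeff_apply]
      exact isUnit_iff_ne_zero.2 h
    obtain ⟨g, hg⟩ := hu.exists_right_inv
    have h1 : (f : MvPowerSeries (Fin 2) k) * sigma ζ a g = 1 := by
      have h2 := congrArg (sigma ζ a) hg
      rwa [map_mul, map_one, mem_invariantRing.1 f.2] at h2
    have h3 : sigma ζ a g = g := by
      calc sigma ζ a g = (f * g) * sigma ζ a g := by rw [hg, one_mul]
        _ = g * (f * sigma ζ a g) := by ring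
        _ = g := by rw [h1, mul_one]
    exact IsUnit.of_mul_eq_one ⟨g, h3⟩ (Subtype.ext hg)
  · intro h h0
    have := (h.map (invariantRing ζ a).val)
    rw [MvPowerSeries.isUnit_iff_constantCoeff, ← coeff_zero_eq_constantCoeff_apply] at this
    exact this.ne_zero h0

/-! ### The invariant ring is Noetherian of dimension two -/

/-- The projection of `k[[x, y]]` onto the invariant ring. -/
lemma exists_reynolds (hn : 0 < n) (hζ : IsPrimitiveRoot ζ n) :
    ∃ π : MvPowerSeries (Fin 2) k →+ invariantRing ζ a,
      (∀ f : invariantRing ζ a, π f = f) ∧ ∀ s (f : invariantRing ζ a), π (s * f) = π s * f := by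
  classical
  let P : MvPowerSeries (Fin 2) k → MvPowerSeries (Fin 2) k :=
    fun f v => if HasWeight n a 0 v then coeff v f else 0
  have hP : ∀ f v, coeff v (P f) = if HasWeight n a 0 v then coeff v f else 0 := fun _ _ => rfl
  have hmem : ∀ f, P f ∈ invariantRing ζ a := by
    intro f
    rw [mem_invariantRing_iff hn hζ]
    intro v hv
    rw [hP] at hv
    by_contra h
    exact hv (if_neg h)
  refine ⟨⟨⟨fun f => ⟨P f, hmem f⟩, Subtype.ext ?_⟩, fun f g => Subtype.ext ?_⟩, fun f => Subtype.ext ?_,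
    fun s f => Subtype.ext ?_⟩
  · ext v
    simp [hP]
  · ext v
    change coeff v (P (f + g)) = coeff v (P f + P g)
    rw [map_add, hP, hP, hP, map_add]
    split_ifs <;> simp
  · ext v
    change coeff v (P f) = _
    rw [hP]
    split_ifs with h
    · rfl
    · by_contra h'
      exact h ((mem_invariantRing_iff hn hζ _).1 f.2 v (Ne.symm h'))
  · ext v
    change coeff v (P (s * f)) = coeff v (P s * (f : MvPowerSeries (Fin 2) k))
    have hterm : ∀ p ∈ Finset.HasAntidiagonal.antidiagonal v, coeff p.1 (P s) * coeff p.2 (f : MvPowerSeries (Fin 2) k) =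
        if HasWeight n a 0 v then coeff p.1 s * coeff p.2 (f : MvPowerSeries (Fin 2) k) else 0 := by
      rintro ⟨p, q⟩ hpq
      rw [Finset.HasAntidiagonal.mem_antidiagonal] at hpq
      dsimp only at hpq ⊢
      by_cases hq : coeff q (f : MvPowerSeries (Fin 2) k) = 0
      · simp [hq]
      · have hw := (mem_invariantRing_iff hn hζ _).1 f.2 q hq
        rw [hP]
        have : HasWeight n a 0 p ↔ HasWeight n a 0 v := by
          subst hpq
          exact hw.add_iff.symm
        simp only [this]
        split_ifs <;> simp
    rw [coeff_mul v (P s), Finset.sum_congr rfl hterm, hP]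
    split_ifs
    · rw [coeff_mul]
    · simp

/-- The projection π is R-linear and fixes R, so IS ∩ R = I for every ideal I of R. Thus I ↦ IS is
strictly monotone into the ideals of the Noetherian ring S. -/
lemma isNoetherianRing_invariantRing (hn : 0 < n) (hζ : IsPrimitiveRoot ζ n) :
    IsNoetherianRing (invariantRing ζ a) := by
  obtain ⟨π, hπ1, hπ2⟩ := exists_reynolds (a := a) hn hζ
  have hcomap : ∀ I : Ideal (invariantRing ζ a), ∀ x : invariantRing ζ a,
      (x : MvPowerSeries (Fin 2) k) ∈ I.map (invariantRing ζ a).val → x ∈ I := by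
    intro I x hx
    -- The multiplier b is needed because π is not S-linear; it absorbs scalars in the span
    -- induction.
    have key : ∀ s ∈ I.map (invariantRing ζ a).val, ∀ b, π (b * s) ∈ I := by
      intro s hs
      induction hs using Submodule.span_induction with
      | mem s hs =>
        obtain ⟨f, hf, rfl⟩ := hs
        intro b
        have := hπ2 b f
        change π (b * (f : MvPowerSeries (Fin 2) k)) ∈ I
        rw [this]
        exact I.mul_mem_left _ hf
      | zero => intro b; rw [mul_zero, map_zero]; exact I.zero_mem
      | add s s' _ _ h h' => intro b; rw [mul_add, map_add]; exact I.add_mem (h b) (h' b)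
      | smul c s _ h => intro b; rw [smul_eq_mul, ← mul_assoc]; exact h _
    have := key _ hx 1
    rwa [one_mul, hπ1] at this
  have hmono : StrictMono fun I : Ideal (invariantRing ζ a) => I.map (invariantRing ζ a).val := by
    refine Monotone.strictMono_of_injective (fun I J h => Ideal.map_mono h) fun I J h => ?_
    ext x
    exact ⟨fun hx => hcomap J x (h ▸ Ideal.mem_map_of_mem _ hx),
      fun hx => hcomap I x ((show I.map _ = J.map _ from h) ▸ Ideal.mem_map_of_mem _ hx)⟩
  have : WellFoundedGT (Ideal (invariantRing ζ a)) := hmono.wellFoundedGT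
  exact (isNoetherian_iff' (R := invariantRing ζ a)).2 this

/-- The invariant monomial `x ^ n`. -/
lemma hasWeight_expo_left (n a : ℕ) : HasWeight n a 0 (expo n 0) := by
  simp [HasWeight]

lemma hasWeight_expo_right (n a : ℕ) : HasWeight n a 0 (expo 0 n) := by
  simp [HasWeight]

/-- A model of `M_t`: a module over the invariant ring with an embedding into `k[[x, y]]` whose
range consists of the power series in the monomials of `M_t`. -/
structure IsSemiInvariantModule (ζ : k) (n a t : ℕ) (X : Type*) [AddCommGroup X]
    [Module (invariantRing ζ a) X] (ι : X →+ MvPowerSeries (Fin 2) k) : Prop where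
  injective : Function.Injective ι
  map_smul : ∀ (c : invariantRing ζ a) x, ι (c • x) = c * ι x
  weight : ∀ x v, coeff v (ι x) ≠ 0 → HasWeight n a t v
  exists_of : ∀ f, (∀ v, coeff v f ≠ 0 → HasWeight n a t v) → ∃ x, ι x = f

lemma isSemiInvariantModule_M (hn : 0 < n) (hζ : IsPrimitiveRoot ζ n) (t : ℕ) :
    IsSemiInvariantModule ζ n a t (M ζ a t) ⟨⟨Subtype.val, rfl⟩, fun _ _ => rfl⟩ where
  injective := Subtype.val_injective
  map_smul _ _ := rfl
  weight x := (mem_M_iff hn hζ t _).1 x.2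
  exists_of f hf := ⟨⟨f, (mem_M_iff hn hζ t f).2 hf⟩, rfl⟩

/-- R itself is the case t = 0, so e(R) comes from the same computation as e(M_t). -/
lemma isSemiInvariantModule_invariantRing (hn : 0 < n) (hζ : IsPrimitiveRoot ζ n) :
    IsSemiInvariantModule ζ n a 0 (invariantRing ζ a) ⟨⟨Subtype.val, rfl⟩, fun _ _ => rfl⟩ where
  injective := Subtype.val_injective
  map_smul _ _ := rfl
  weight x := (mem_invariantRing_iff hn hζ _).1 x.2
  exists_of f hf := ⟨⟨f, (mem_invariantRing_iff hn hζ f).2 hf⟩, rfl⟩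

variable {X : Type*} [AddCommGroup X] [Module (invariantRing ζ a) X]
  {ι : X →+ MvPowerSeries (Fin 2) k}

/-- Reducing both exponents modulo n splits off powers of the invariants x^n and y^n, so the
monomials in a finite box generate. -/
lemma IsSemiInvariantModule.finite (E : IsSemiInvariantModule ζ n a t X ι) (hn : 0 < n)
    (hζ : IsPrimitiveRoot ζ n) : Module.Finite (invariantRing ζ a) X := by
  classical
  let G : Finset (Fin 2 →₀ ℕ) := (Finset.Iic (expo n n)).filter (HasWeight n a t)
  have hGw : ∀ w ∈ G, HasWeight n a t w := fun w hw => (Finset.mem_filter.1 hw).2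
  choose g hg using fun w : G => E.exists_of (monomial w.1 1)
    ((mem_M_iff hn hζ t _).1 (monomial_mem_M hn hζ (hGw _ w.2) 1))
  refine ⟨⟨G.attach.image g, ?_⟩⟩
  rw [eq_top_iff]
  rintro x -
  obtain ⟨f, hf⟩ : ∃ f, ι x = f := ⟨_, rfl⟩
  have hf' := E.weight x
  rw [hf] at hf'
  have hdec : ∀ v, coeff v f ≠ 0 → ∃ w ∈ G, w ≤ v ∧ HasWeight n a 0 (v - w) := by
    intro v hv
    have hle : expo (v 0 % n) (v 1 % n) ≤ v := by
      rw [le_iff_fin_two]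
      simp [Nat.mod_le]
    have hw : HasWeight n a t (expo (v 0 % n) (v 1 % n)) := by
      have h1 := hf' v hv
      simp only [HasWeight, expo_zero, expo_one] at h1 ⊢
      have h2 : ((v 0 % n : ℕ) : ℤ) + ((v 1 % n : ℕ) : ℤ) * a - t =
          ((v 0 : ℤ) + v 1 * a - t) - n * ((v 0 / n : ℕ) + (v 1 / n : ℕ) * a) := by
        have e0 : (v 0 : ℤ) = n * (v 0 / n : ℕ) + (v 0 % n : ℕ) := by
          exact_mod_cast (Nat.div_add_mod (v 0) n).symm
        have e1 : (v 1 : ℤ) = n * (v 1 / n : ℕ) + (v 1 % n : ℕ) := by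
          exact_mod_cast (Nat.div_add_mod (v 1) n).symm
        linear_combination -e0 - (a : ℤ) * e1
      rw [h2]
      exact dvd_sub h1 (dvd_mul_right _ _)
    refine ⟨_, Finset.mem_filter.2 ⟨Finset.mem_Iic.2 ?_, hw⟩, hle, ?_⟩
    · rw [le_iff_fin_two]
      simp only [expo_zero, expo_one]
      exact ⟨(Nat.mod_lt _ hn).le, (Nat.mod_lt _ hn).le⟩
    · rw [← hw.add_iff, tsub_add_cancel_of_le hle]
      exact hf' v hv
  obtain ⟨F, hF, hF'⟩ := exists_decomposition f G (fun _ u => HasWeight n a 0 u) hdec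
  have hFmem : ∀ w : G, F w.1 ∈ invariantRing ζ a := fun w =>
    (mem_invariantRing_iff hn hζ _).2 fun u hu => (hF' w.1 w.2 u hu).1
  have hsum : x = ∑ w ∈ G.attach, (⟨F w.1, hFmem w⟩ : invariantRing ζ a) • g w := by
    apply E.injective
    rw [map_sum, hf]
    simp only [E.map_smul, hg]
    rw [Finset.sum_attach G fun w => F w * monomial w 1, hF]
    exact Finset.sum_congr rfl fun w _ => mul_comm _ _
  rw [hsum]
  refine Submodule.sum_mem _ fun w hw => Submodule.smul_mem _ _ (Submodule.subset_span ?_)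
  exact Finset.mem_coe.2 (Finset.mem_image_of_mem _ hw)

end Series

end CyclicQuotient

namespace CyclicQuotient

open MvPowerSeries
open scoped Pointwise

section Filtration

variable {k : Type*} [Field k] {n a r t : ℕ} {α : ℕ → ℕ} {ζ : k}
  {X : Type*} [AddCommGroup X] [Module (invariantRing ζ a) X] {ι : X →+ MvPowerSeries (Fin 2) k}

/-! ### The filtration of `M_t` by levels -/

lemma level_finsupp_add {p q : Fin 2 →₀ ℕ} (hp : HasWeight n a 0 p) (u : ℕ) :
    level n a α t ((p + q) 0 : ℕ) ((p + q) 1 : ℕ) u =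
      level n a α t (q 0) (q 1) u + level n a α 0 (p 0) (p 1) u := by
  have hp' : (n : ℤ) ∣ (p 0 : ℤ) + p 1 * a := by simpa [HasWeight] using hp
  rw [← level_add hp']
  simp only [Finsupp.add_apply]
  push_cast
  rw [add_comm (p 0 : ℤ), add_comm (p 1 : ℤ)]

lemma IsHJData.level_finsupp_nonneg (D : IsHJData n a r α) {p : Fin 2 →₀ ℕ}
    (hp : HasWeight n a 0 p) {u : ℕ} (hu : u ≤ r) : 0 ≤ level n a α 0 (p 0) (p 1) u :=
  D.level_nonneg D.n_pos hp (by positivity) (by positivity) u (by omega)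

lemma IsHJData.level_finsupp_pos (D : IsHJData n a r α) {p : Fin 2 →₀ ℕ}
    (hp : HasWeight n a 0 p) (hp0 : p ≠ 0) {u : ℕ} (h1 : 1 ≤ u) (hu : u ≤ r) :
    1 ≤ level n a α 0 (p 0) (p 1) u := by
  refine D.level_pos (by simpa [HasWeight] using hp) (by positivity) (by positivity) ?_ u h1 hu
  exact_mod_cast (ne_zero_iff_fin_two p).1 hp0

/-- The elements of `M_t` all of whose monomials have levels at least `p`. -/
def levelSubmodule (E : IsSemiInvariantModule ζ n a t X ι) (D : IsHJData n a r α)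
    (hζ : IsPrimitiveRoot ζ n) (p : ℕ) : Submodule (invariantRing ζ a) X where
  carrier := {f | ∀ v, coeff v (ι f) ≠ 0 →
    ∀ u, 1 ≤ u → u ≤ r → (p : ℤ) ≤ level n a α t (v 0) (v 1) u}
  zero_mem' v hv := absurd (by simp) hv
  add_mem' {f g} hf hg v hv := by
    rw [map_add, map_add] at hv
    by_cases h : coeff v (ι f) = 0
    · rw [h, zero_add] at hv
      exact hg v hv
    · exact hf v h
  smul_mem' c f hf v hv u h1 hu := by
    rw [E.map_smul] at hv
    obtain ⟨p', q, rfl, hp, hq⟩ := exists_of_coeff_mul_ne_zero hv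
    have hpw := (mem_invariantRing_iff D.n_pos hζ _).1 c.2 p' hp
    rw [level_finsupp_add hpw]
    have := hf q hq u h1 hu
    have := D.level_finsupp_nonneg hpw hu
    linarith

lemma mem_levelSubmodule (E : IsSemiInvariantModule ζ n a t X ι) (D : IsHJData n a r α) (hζ : IsPrimitiveRoot ζ n) {p : ℕ}
    {f : X} : f ∈ levelSubmodule E D hζ p ↔
      ∀ v, coeff v (ι f) ≠ 0 →
        ∀ u, 1 ≤ u → u ≤ r → (p : ℤ) ≤ level n a α t (v 0) (v 1) u := Iff.rfl

lemma levelSubmodule_zero (E : IsSemiInvariantModule ζ n a t X ι) (D : IsHJData n a r α) (hζ : IsPrimitiveRoot ζ n) (ht : t < n) :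
    levelSubmodule E D hζ 0 = ⊤ := by
  rw [eq_top_iff]
  intro f _ v hv u _ hu
  have hw := E.weight f v hv
  exact D.level_nonneg ht hw (by positivity) (by positivity) u (by omega)

lemma levelSubmodule_anti (E : IsSemiInvariantModule ζ n a t X ι) (D : IsHJData n a r α) (hζ : IsPrimitiveRoot ζ n) (p : ℕ) :
    levelSubmodule E D hζ (p + 1) ≤ levelSubmodule E D hζ p := by
  intro f hf v hv u h1 hu
  have := hf v hv u h1 hu
  push_cast at this
  linarith

/-- One inclusion holds because levels add and nonconstant invariants have levels ≥ 1. The other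
applies `IsHJData.exists_sub` to each monomial; its bound on exponents makes the decomposition a
finite sum, even for power series. -/
lemma maximalIdeal_smul_levelSubmodule (E : IsSemiInvariantModule ζ n a t X ι) (D : IsHJData n a r α) (hζ : IsPrimitiveRoot ζ n)
    (ht : t < n) (p : ℕ) :
    IsLocalRing.maximalIdeal (invariantRing ζ a) • levelSubmodule E D hζ p =
      levelSubmodule E D hζ (p + 1) := by
  classical
  apply le_antisymm
  · rw [Submodule.smul_le]
    intro c hc f hf v hv u h1 hu
    rw [E.map_smul] at hv
    obtain ⟨p', q, rfl, hp, hq⟩ := exists_of_coeff_mul_ne_zero hv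
    have hpw := (mem_invariantRing_iff D.n_pos hζ _).1 c.2 p' hp
    rw [mem_maximalIdeal_iff] at hc
    have hp0 : p' ≠ 0 := by
      rintro rfl
      exact hp hc
    rw [level_finsupp_add hpw]
    have := hf q hq u h1 hu
    have := D.level_finsupp_pos hpw hp0 h1 hu
    push_cast
    linarith
  · intro x hfp
    obtain ⟨f, hf⟩ : ∃ f, ι x = f := ⟨_, rfl⟩
    have hf' := E.weight x
    rw [mem_levelSubmodule] at hfp
    rw [hf] at hf' hfp
    let G : Finset (Fin 2 →₀ ℕ) :=
      (Finset.Iic (expo n n)).filter fun w => HasWeight n a 0 w ∧ w ≠ 0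
    have hGw : ∀ w ∈ G, HasWeight n a 0 w ∧ w ≠ 0 := fun w hw => (Finset.mem_filter.1 hw).2
    obtain ⟨F, hF, hF'⟩ := exists_decomposition f G
      (fun _ u => HasWeight n a t u ∧ ∀ w, 1 ≤ w → w ≤ r → (p : ℤ) ≤ level n a α t (u 0) (u 1) w)
      (by
        intro v hv
        obtain ⟨i', j', hi0, hj0, hin, hjn, hne, hdvd, hi, hj, hlev⟩ := D.exists_sub ht (hf' v hv)
          (by positivity) (by positivity) (k := p) (by positivity) (hfp v hv)
        lift i' to ℕ using hi0
        lift j' to ℕ using hj0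
        have hle : expo i' j' ≤ v := by
          rw [le_iff_fin_two]
          simp only [expo_zero, expo_one]
          omega
        have hw : HasWeight n a 0 (expo i' j') := by simpa [HasWeight] using hdvd
        refine ⟨expo i' j', Finset.mem_filter.2 ⟨Finset.mem_Iic.2 ?_, hw, ?_⟩, hle, ?_, ?_⟩
        · rw [le_iff_fin_two]
          simp only [expo_zero, expo_one]
          omega
        · rw [ne_zero_iff_fin_two]
          simp only [expo_zero, expo_one]
          omega
        · rw [← hw.add_iff', add_tsub_cancel_of_le hle]
          exact hf' v hv
        · have h0 : (((v - expo i' j') 0 : ℕ) : ℤ) = v 0 - i' := by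
            simp only [Finsupp.tsub_apply, expo_zero]
            omega
          have h1 : (((v - expo i' j') 1 : ℕ) : ℤ) = v 1 - j' := by
            simp only [Finsupp.tsub_apply, expo_one]
            omega
          rw [h0, h1]
          exact hlev)
    choose g hg using fun w : G => E.exists_of (F w.1) fun u hu => (hF' w.1 w.2 u hu).1.1
    have hsum : x = ∑ w ∈ G.attach,
        (⟨monomial w.1 1, monomial_mem_invariantRing D.n_pos hζ (hGw _ w.2).1 1⟩ :
          invariantRing ζ a) • g w := by
      apply E.injective
      rw [map_sum, hf]
      simp only [E.map_smul, hg]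
      rw [Finset.sum_attach G fun w => monomial w 1 * F w, hF]
    rw [hsum]
    refine Submodule.sum_mem _ fun w _ => Submodule.smul_mem_smul ?_ ?_
    · rw [mem_maximalIdeal_iff]
      simp only [coeff_monomial]
      rw [if_neg (hGw _ w.2).2.symm]
    · intro u hu
      rw [hg] at hu
      exact (hF' w.1 w.2 u hu).1.2

lemma maximalIdeal_pow_smul_top (E : IsSemiInvariantModule ζ n a t X ι) (D : IsHJData n a r α) (hζ : IsPrimitiveRoot ζ n)
    (ht : t < n) (p : ℕ) :
    IsLocalRing.maximalIdeal (invariantRing ζ a) ^ p • (⊤ : Submodule (invariantRing ζ a) X) =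
      levelSubmodule E D hζ p := by
  induction p with
  | zero => rw [pow_zero, Submodule.one_smul, levelSubmodule_zero E D hζ ht]
  | succ p ih =>
    rw [pow_succ', Submodule.mul_smul, ih, maximalIdeal_smul_levelSubmodule E D hζ ht]

/-- The monomials of `M_t` whose smallest level is `p`, as exponent vectors. -/
lemma IsHJData.exists_layer_finsupp (D : IsHJData n a r α) (ht : t < n) (p : ℕ) :
    ∃ L : Finset (Fin 2 →₀ ℕ),
      (L.card : ℤ) = (∑ u ∈ Finset.Icc 1 r, (α u : ℤ) - 2 * ((r : ℤ) - 1)) * p +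
        ∑ u ∈ Finset.Icc 1 r, digit (iSeries n a α) t u + 1 ∧
      ∀ v, v ∈ L ↔ HasWeight n a t v ∧
        (∀ u, 1 ≤ u → u ≤ r → (p : ℤ) ≤ level n a α t (v 0) (v 1) u) ∧
        ∃ u, 1 ≤ u ∧ u ≤ r ∧ level n a α t (v 0) (v 1) u = p := by
  classical
  obtain ⟨L, hcard, hL⟩ := D.exists_layer ht p
  refine ⟨L.image fun q => expo q.1.toNat q.2.toNat, ?_, ?_⟩
  · rw [Finset.card_image_of_injOn, hcard]
    rintro ⟨i, j⟩ hij ⟨i', j'⟩ hij' heq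
    have h := (hL i j).1 hij
    have h' := (hL i' j').1 hij'
    have h0 := DFunLike.congr_fun heq 0
    have h1 := DFunLike.congr_fun heq 1
    simp only [expo_zero, expo_one] at h0 h1
    ext <;> dsimp only <;> omega
  · intro v
    rw [Finset.mem_image]
    constructor
    · rintro ⟨⟨i, j⟩, hij, rfl⟩
      obtain ⟨hi, hj, h⟩ := (hL i j).1 hij
      simp only [HasWeight, expo_zero, expo_one, Int.toNat_of_nonneg hi, Int.toNat_of_nonneg hj]
      exact h
    · intro h
      refine ⟨(v 0, v 1), (hL _ _).2 ⟨by positivity, by positivity, h⟩, ?_⟩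
      simp only [Int.toNat_natCast]
      exact expo_eta v

/-- The class in the residue field of the constant `c`. -/
noncomputable def residueConst (ζ : k) (a : ℕ) :
    k →+* invariantRing ζ a ⧸ IsLocalRing.maximalIdeal (invariantRing ζ a) :=
  (Ideal.Quotient.mk _).comp (algebraMap k (invariantRing ζ a))

lemma residueConst_coeff (f : invariantRing ζ a) :
    residueConst ζ a (coeff 0 (f : MvPowerSeries (Fin 2) k)) = Ideal.Quotient.mk _ f := by
  change Ideal.Quotient.mk _ (algebraMap k (invariantRing ζ a) _) = _
  rw [Ideal.Quotient.eq, mem_maximalIdeal_iff]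
  change coeff 0 (algebraMap k (MvPowerSeries (Fin 2) k) _ - (f : MvPowerSeries (Fin 2) k)) = 0
  rw [map_sub, MvPowerSeries.algebraMap_apply, coeff_zero_C]
  simp

lemma residueConst_surjective : Function.Surjective (residueConst ζ a) := by
  intro x
  obtain ⟨f, rfl⟩ := Ideal.Quotient.mk_surjective x
  exact ⟨_, residueConst_coeff f⟩

lemma residueConst_eq_zero {c : k} (h : residueConst ζ a c = 0) : c = 0 := by
  have : residueConst ζ a c = residueConst ζ a 0 := by rw [h, map_zero]
  let _ : Field (invariantRing ζ a ⧸ IsLocalRing.maximalIdeal (invariantRing ζ a)) :=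
    Ideal.Quotient.field _
  exact (residueConst ζ a).injective this

/-- The length of `M_t / 𝔪 ^ (p + 1) M_t`. -/
lemma length_levelSubmodule_succ (E : IsSemiInvariantModule ζ n a t X ι) (D : IsHJData n a r α) (hζ : IsPrimitiveRoot ζ n) (p : ℕ)
    (L : Finset (Fin 2 →₀ ℕ)) (hL : ∀ v, v ∈ L ↔ HasWeight n a t v ∧
        (∀ u, 1 ≤ u → u ≤ r → (p : ℤ) ≤ level n a α t (v 0) (v 1) u) ∧
        ∃ u, 1 ≤ u ∧ u ≤ r ∧ level n a α t (v 0) (v 1) u = p) :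
    Module.length (invariantRing ζ a) (X ⧸ levelSubmodule E D hζ (p + 1)) =
      L.card + Module.length (invariantRing ζ a) (X ⧸ levelSubmodule E D hζ p) := by
  classical
  let φ : levelSubmodule E D hζ p →ₗ[invariantRing ζ a]
      (L → invariantRing ζ a ⧸ IsLocalRing.maximalIdeal (invariantRing ζ a)) :=
    { toFun := fun f v => residueConst ζ a (coeff v.1 (ι f.1))
      map_add' := fun f g => by
        funext v
        change residueConst ζ a (coeff v.1 (ι (f.1 + g.1))) = _
        rw [map_add, map_add, map_add]
        rfl
      map_smul' := fun c f => by
        funext v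
        change residueConst ζ a (coeff v.1 (ι (c • f.1))) =
          Ideal.Quotient.mk _ c * residueConst ζ a (coeff v.1 (ι f.1))
        rw [E.map_smul, ← residueConst_coeff, ← map_mul]
        congr 1
        -- Only the constant term of c contributes: any other term of c raises every level above p,
        -- while v attains level p.
        rw [coeff_mul, Finset.sum_eq_single_of_mem (0, v.1)
          (Finset.HasAntidiagonal.mem_antidiagonal.2 (zero_add _))]
        rintro ⟨p', q⟩ hpq hne
        rw [Finset.HasAntidiagonal.mem_antidiagonal] at hpq
        dsimp only at hpq ⊢
        by_contra hcon
        have hp := left_ne_zero_of_mul hcon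
        have hq := right_ne_zero_of_mul hcon
        have hpw := (mem_invariantRing_iff D.n_pos hζ _).1 c.2 p' hp
        have hp0 : p' ≠ 0 := by
          rintro rfl
          rw [zero_add] at hpq
          exact hne (by rw [hpq])
        obtain ⟨-, -, u, h1, hu, hlev⟩ := (hL v.1).1 v.2
        rw [← hpq, level_finsupp_add hpw] at hlev
        have h2 := f.2 q hq u h1 hu
        have h3 := D.level_finsupp_pos hpw hp0 h1 hu
        linarith }
  have hφ : ∀ f v, φ f v = residueConst ζ a (coeff v.1 (ι f.1)) :=
    fun _ _ => rfl
  have hsurj : Function.Surjective φ := by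
    intro g
    choose c hc using fun v => residueConst_surjective (g v)
    let f : MvPowerSeries (Fin 2) k := fun v => if h : v ∈ L then c ⟨v, h⟩ else 0
    have hf : ∀ v, coeff v f = if h : v ∈ L then c ⟨v, h⟩ else 0 := fun _ => rfl
    have hfL : ∀ v, coeff v f ≠ 0 → v ∈ L := by
      intro v hv
      by_contra h
      rw [hf, dif_neg h] at hv
      exact hv rfl
    obtain ⟨x, hx⟩ := E.exists_of f fun v hv => ((hL v).1 (hfL v hv)).1
    refine ⟨⟨x, fun v hv => ((hL v).1 (hfL v (hx ▸ hv))).2.1⟩, ?_⟩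
    funext v
    rw [hφ, ← hc v]
    dsimp only
    rw [hx, hf, dif_pos v.2]
  have hker : LinearMap.ker φ = (levelSubmodule E D hζ (p + 1)).comap
      (levelSubmodule E D hζ p).subtype := by
    ext f
    rw [LinearMap.mem_ker, Submodule.mem_comap, Submodule.subtype_apply]
    constructor
    · intro h v hv u h1 hu
      have h2 := f.2 v hv u h1 hu
      have hw := E.weight f.1 v hv
      have hne : level n a α t (v 0) (v 1) u ≠ p := by
        intro heq
        have hvL : v ∈ L := (hL v).2 ⟨hw, f.2 v hv, u, h1, hu, heq⟩
        have := congrFun h ⟨v, hvL⟩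
        rw [hφ] at this
        exact hv (residueConst_eq_zero this)
      push_cast
      omega
    · intro h
      funext v
      rw [hφ]
      have : coeff v.1 (ι f.1) = 0 := by
        by_contra hv
        obtain ⟨-, -, u, h1, hu, hlev⟩ := (hL v.1).1 v.2
        have := h v.1 hv u h1 hu
        push_cast at this
        omega
      rw [this, map_zero]
      rfl
  rw [length_quotient_eq_card_add (levelSubmodule_anti E D hζ p) φ hsurj hker, Fintype.card_coe]

/-! ### Depth and dimension -/

/-- The invariant `x ^ n`. -/
noncomputable def xPow (hn : 0 < n) (hζ : IsPrimitiveRoot ζ n) : invariantRing ζ a :=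
  ⟨monomial (expo n 0) 1, monomial_mem_invariantRing hn hζ (hasWeight_expo_left n a) 1⟩

/-- The invariant `y ^ n`. -/
noncomputable def yPow (hn : 0 < n) (hζ : IsPrimitiveRoot ζ n) : invariantRing ζ a :=
  ⟨monomial (expo 0 n) 1, monomial_mem_invariantRing hn hζ (hasWeight_expo_right n a) 1⟩

lemma xPow_yPow_mem (hn : 0 < n) (hζ : IsPrimitiveRoot ζ n) :
    ∀ f ∈ [xPow (a := a) hn hζ, yPow hn hζ],
      f ∈ IsLocalRing.maximalIdeal (invariantRing ζ a) := by
  classical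
  have h1 : xPow (a := a) hn hζ ∈ IsLocalRing.maximalIdeal (invariantRing ζ a) := by
    rw [mem_maximalIdeal_iff]
    simp only [xPow, coeff_monomial]
    rw [if_neg (Ne.symm ((ne_zero_iff_fin_two _).2 (Or.inl (by simpa using hn.ne'))))]
  have h2 : yPow (a := a) hn hζ ∈ IsLocalRing.maximalIdeal (invariantRing ζ a) := by
    rw [mem_maximalIdeal_iff]
    simp only [yPow, coeff_monomial]
    rw [if_neg (Ne.symm ((ne_zero_iff_fin_two _).2 (Or.inr (by simpa using hn.ne'))))]
  intro f hf
  rcases List.mem_pair.1 hf with rfl | rfl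
  · exact h1
  · exact h2

namespace IsSemiInvariantModule

lemma nontrivial (E : IsSemiInvariantModule ζ n a t X ι) (hn : 0 < n)
    (hζ : IsPrimitiveRoot ζ n) : Nontrivial X := by
  have hw : HasWeight n a t (expo t 0) := by simp [HasWeight]
  obtain ⟨x, hx⟩ := E.exists_of _ ((mem_M_iff hn hζ t _).1 (monomial_mem_M hn hζ hw 1))
  refine ⟨x, 0, fun h => ?_⟩
  rw [h, map_zero] at hx
  have := congrArg (coeff (expo t 0)) hx
  simp at this

/-- If x^n g = y^n f, comparing coefficients shows that x^n divides every monomial of f, and the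
quotient again has weight t. Since the sequence lies in 𝔪 and the module is finite and nonzero, weak
regularity suffices. -/
lemma isRegular (E : IsSemiInvariantModule ζ n a t X ι) (hn : 0 < n)
    (hζ : IsPrimitiveRoot ζ n) :
    RingTheory.Sequence.IsRegular X [xPow (a := a) hn hζ, yPow hn hζ] := by
  have := E.finite hn hζ
  have := E.nontrivial hn hζ
  rw [IsLocalRing.isRegular_iff_isWeaklyRegular_of_subset_maximalIdeal (xPow_yPow_mem hn hζ),
    RingTheory.Sequence.isWeaklyRegular_cons_iff, RingTheory.Sequence.isWeaklyRegular_singleton_iff]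
  have hx : ∀ f, ι (xPow (a := a) hn hζ • f) = monomial (expo n 0) 1 * ι f := E.map_smul _
  have hy : ∀ f, ι (yPow (a := a) hn hζ • f) = monomial (expo 0 n) 1 * ι f := E.map_smul _
  constructor
  · intro f g hfg
    apply E.injective
    ext v
    have h := congrArg (fun f => coeff (expo n 0 + v) (ι f)) hfg
    dsimp only at h
    rwa [hx, hx, coeff_add_monomial_mul, coeff_add_monomial_mul, one_mul, one_mul] at h
  · change IsSMulRegular (X ⧸ xPow (a := a) hn hζ • (⊤ : Submodule _ X)) _
    rw [isSMulRegular_quotient_iff_mem_of_smul_mem]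
    intro f hf
    rw [Submodule.mem_smul_pointwise_iff_exists] at hf ⊢
    obtain ⟨g, -, hg⟩ := hf
    have hg' := congrArg ι hg
    rw [hx, hy] at hg'
    have hfw := E.weight f
    obtain ⟨F, hF, hF'⟩ := exists_decomposition (ι f) {expo n 0}
      (fun _ u => HasWeight n a t u) (by
        intro v hv
        refine ⟨_, Finset.mem_singleton_self _, ?_⟩
        have h := congrArg (coeff (expo 0 n + v)) hg'
        rw [coeff_add_monomial_mul, one_mul, coeff_monomial_mul] at h
        have hle : expo n 0 ≤ v := by
          by_contra hle
          rw [if_neg] at h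
          · exact hv h.symm
          · rw [le_iff_fin_two] at hle ⊢
            simpa using hle
        refine ⟨hle, ?_⟩
        rw [← (hasWeight_expo_left n a).add_iff', add_tsub_cancel_of_le hle]
        exact hfw v hv)
    rw [Finset.sum_singleton] at hF
    obtain ⟨x, hx'⟩ := E.exists_of (F (expo n 0)) fun u hu =>
      (hF' _ (Finset.mem_singleton_self _) u hu).1
    refine ⟨x, trivial, E.injective ?_⟩
    rw [hx, hx', hF]

end IsSemiInvariantModule

/-- Monomials of f^n have first level at least n, that is, i + ja ≥ n². With i, j, a ≤ n - 1 the
left side is at most n(n - 1), so x^n or y^n divides the monomial. -/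
lemma pow_mem_ofList (D : IsHJData n a r α) (han : a < n) (hζ : IsPrimitiveRoot ζ n)
    {f : invariantRing ζ a} (hf : f ∈ IsLocalRing.maximalIdeal (invariantRing ζ a)) :
    f ^ n ∈ Ideal.ofList [xPow (a := a) D.n_pos hζ, yPow D.n_pos hζ] := by
  classical
  have hlev : f ^ n ∈ levelSubmodule
      (isSemiInvariantModule_invariantRing (a := a) D.n_pos hζ) D hζ n := by
    rw [← maximalIdeal_pow_smul_top _ D hζ D.n_pos]
    have h1 := Submodule.smul_mem_smul (Ideal.pow_mem_pow hf n)
      (Submodule.mem_top (x := (1 : invariantRing ζ a)))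
    change f ^ n * 1 ∈ _ at h1
    rwa [mul_one] at h1
  have hw := (mem_invariantRing_iff D.n_pos hζ _).1 (f ^ n).2
  have hdec : ∀ v, coeff v ((f ^ n : invariantRing ζ a) : MvPowerSeries (Fin 2) k) ≠ 0 →
      ∃ w ∈ ({expo n 0, expo 0 n} : Finset (Fin 2 →₀ ℕ)), w ≤ v ∧ HasWeight n a 0 (v - w) := by
    intro v hv
    have h1 : (n : ℤ) ≤ ((v 0 : ℤ) + v 1 * a - (0 : ℕ)) / n := hlev v hv 1 le_rfl D.one_le
    rw [Int.le_ediv_iff_mul_le (by exact_mod_cast D.n_pos)] at h1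
    have hor : n ≤ v 0 ∨ n ≤ v 1 := by
      by_contra! hcon
      have h2 : (v 0 : ℤ) ≤ n - 1 := by omega
      have h3 : (v 1 : ℤ) ≤ n - 1 := by omega
      have h4 : (a : ℤ) ≤ n - 1 := by omega
      have h5 : (v 1 : ℤ) * a ≤ (n - 1) * (n - 1) :=
        mul_le_mul h3 h4 (by positivity) (by linarith [Int.natCast_nonneg (v 1)])
      push_cast at h1
      nlinarith
    have aux : ∀ w, HasWeight n a 0 w → w ≤ v → w ≤ v ∧ HasWeight n a 0 (v - w) := by
      intro w hww hle
      refine ⟨hle, ?_⟩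
      rw [← hww.add_iff', add_tsub_cancel_of_le hle]
      exact hw v hv
    rcases hor with h | h
    · exact ⟨expo n 0, by simp, aux _ (hasWeight_expo_left n a)
        ((le_iff_fin_two _ _).2 (by simpa using h))⟩
    · exact ⟨expo 0 n, by simp, aux _ (hasWeight_expo_right n a)
        ((le_iff_fin_two _ _).2 (by simpa using h))⟩
  obtain ⟨F, hF, hF'⟩ := exists_decomposition _ _ (fun _ u => HasWeight n a 0 u) hdec
  have hne : expo n 0 ≠ expo 0 n := by
    intro h
    have := DFunLike.congr_fun h 0
    simp only [expo_zero] at this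
    exact D.n_pos.ne' this
  rw [Finset.sum_pair hne] at hF
  have hm : ∀ w ∈ ({expo n 0, expo 0 n} : Finset (Fin 2 →₀ ℕ)), F w ∈ invariantRing ζ a :=
    fun w hw' => (mem_invariantRing_iff D.n_pos hζ _).2 fun u hu => (hF' w hw' u hu).1
  have hsum : f ^ n = xPow (a := a) D.n_pos hζ * ⟨F (expo n 0), hm _ (by simp)⟩ +
      yPow (a := a) D.n_pos hζ * ⟨F (expo 0 n), hm _ (by simp)⟩ := Subtype.ext hF
  rw [hsum]
  refine Ideal.add_mem _ (Ideal.mul_mem_right _ _ ?_) (Ideal.mul_mem_right _ _ ?_) <;>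
    exact Ideal.subset_span (by simp)

/-- Dividing by the regular sequence x^n, y^n lowers the dimension by 2. By `pow_mem_ofList` every
prime containing both elements is 𝔪, so the quotient has dimension 0. -/
lemma ringKrullDim_invariantRing (D : IsHJData n a r α) (han : a < n)
    (hζ : IsPrimitiveRoot ζ n) : ringKrullDim (invariantRing ζ a) = 2 := by
  have := isNoetherianRing_invariantRing (a := a) D.n_pos hζ
  have hreg := (isSemiInvariantModule_invariantRing (a := a) D.n_pos hζ).isRegular D.n_pos hζ
  rw [← ringKrullDim_add_length_eq_ringKrullDim_of_isRegular _ hreg]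
  have hle : Ideal.ofList [xPow (a := a) D.n_pos hζ, yPow D.n_pos hζ] ≤
      IsLocalRing.maximalIdeal (invariantRing ζ a) :=
    Ideal.span_le.2 fun f hf => xPow_yPow_mem D.n_pos hζ f hf
  have : Nontrivial (invariantRing ζ a ⧸
      Ideal.ofList [xPow (a := a) D.n_pos hζ, yPow D.n_pos hζ]) :=
    Ideal.Quotient.nontrivial_iff.2 fun h =>
      (IsLocalRing.maximalIdeal.isMaximal _).ne_top (top_le_iff.1 (h ▸ hle))
  have h0 : ringKrullDim (invariantRing ζ a ⧸
      Ideal.ofList [xPow (a := a) D.n_pos hζ, yPow D.n_pos hζ]) = 0 := by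
    rw [← ringKrullDimZero_iff_ringKrullDim_eq_zero, Ring.krullDimLE_zero_iff]
    intro P hP
    have hmax : P.comap (Ideal.Quotient.mk _) = IsLocalRing.maximalIdeal (invariantRing ζ a) := by
      refine le_antisymm (IsLocalRing.le_maximalIdeal (Ideal.IsPrime.ne_top inferInstance)) ?_
      intro f hf
      refine Ideal.IsPrime.mem_of_pow_mem inferInstance n ?_
      rw [Ideal.mem_comap, Ideal.Quotient.eq_zero_iff_mem.2 (pow_mem_ofList D han hζ hf)]
      exact P.zero_mem
    have : (P.comap (Ideal.Quotient.mk (Ideal.ofList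
        [xPow (a := a) D.n_pos hζ, yPow D.n_pos hζ]))).IsMaximal := by
      rw [hmax]
      exact IsLocalRing.maximalIdeal.isMaximal _
    exact Ideal.map_comap_of_surjective _ Ideal.Quotient.mk_surjective P ▸
      (Ideal.map_eq_top_or_isMaximal_of_surjective _ Ideal.Quotient.mk_surjective this).resolve_left
        (by rw [Ideal.map_comap_of_surjective _ Ideal.Quotient.mk_surjective]; exact hP.ne_top)
  rw [h0]
  rfl

lemma dim_invariantRing (D : IsHJData n a r α) (han : a < n) (hζ : IsPrimitiveRoot ζ n) :
    dim (invariantRing ζ a) = 2 := by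
  rw [dim, ringKrullDim_invariantRing D han hζ]
  rfl

lemma IsSemiInvariantModule.isMCM (E : IsSemiInvariantModule ζ n a t X ι)
    (D : IsHJData n a r α) (han : a < n) (hζ : IsPrimitiveRoot ζ n) :
    IsMCM (invariantRing ζ a) X := by
  have hfin := E.finite D.n_pos hζ
  refine ⟨hfin, ?_⟩
  have hN := isNoetherianRing_invariantRing (a := a) D.n_pos hζ
  have hdepth : depth (invariantRing ζ a) X = 2 := by
    apply le_antisymm
    -- A regular sequence lowers the dimension of the support by its length, and the final quotient
    -- is nonzero, so its support has dimension at least 0.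
    · refine iSup₂_le fun rs hrs => ?_
      have h1 := Module.supportDim_add_length_eq_supportDim_of_isRegular rs hrs.2
      have h2 := Module.supportDim_le_ringKrullDim (invariantRing ζ a) X
      rw [ringKrullDim_invariantRing D han hζ, ← h1] at h2
      have hnt := hrs.2.quot_ofList_smul_nontrivial ⊤
      have h3 : (0 : WithBot ℕ∞) ≤ Module.supportDim (invariantRing ζ a)
          (X ⧸ Ideal.ofList rs • (⊤ : Submodule (invariantRing ζ a) X)) := by
        have := (Module.supportDim_ne_bot_iff_nontrivial (invariantRing ζ a)
          (X ⧸ Ideal.ofList rs • (⊤ : Submodule (invariantRing ζ a) X))).2 hnt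
        obtain ⟨c, hc⟩ := WithBot.ne_bot_iff_exists.1 this
        rw [← hc]
        exact_mod_cast zero_le
      have h4 : ((rs.length : ℕ) : WithBot ℕ∞) ≤ 2 :=
        (le_add_of_nonneg_left h3).trans h2
      exact_mod_cast h4
    · exact le_iSup₂_of_le (f := fun rs _ => ((List.length rs : ℕ) : ℕ∞)) _
        ⟨xPow_yPow_mem D.n_pos hζ, E.isRegular D.n_pos hζ⟩ le_rfl
  rw [hdepth, ringKrullDim_invariantRing D han hζ]
  rfl

/-- The Hilbert-Samuel function of `M_t`. -/
lemma IsSemiInvariantModule.length_quotient (E : IsSemiInvariantModule ζ n a t X ι)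
    (D : IsHJData n a r α) (hζ : IsPrimitiveRoot ζ n) (ht : t < n) :
    ∃ l : ℕ → ℕ, (∀ m, Module.length (invariantRing ζ a) (X ⧸
      (IsLocalRing.maximalIdeal (invariantRing ζ a) ^ m •
        (⊤ : Submodule (invariantRing ζ a) X))) = l m) ∧
      ∀ m, (l m : ℝ) = (∑ u ∈ Finset.Icc 1 r, (α u : ℝ) - 2 * ((r : ℝ) - 1)) * (m * (m - 1) / 2) +
        (((∑ u ∈ Finset.Icc 1 r, digit (iSeries n a α) t u : ℤ) : ℝ) + 1) * m := by
  choose L hLcard hL using fun p => D.exists_layer_finsupp ht p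
  refine ⟨fun m => ∑ p ∈ Finset.range m, (L p).card, fun m => ?_, fun m => ?_⟩
  · rw [maximalIdeal_pow_smul_top E D hζ ht]
    induction m with
    | zero =>
      rw [levelSubmodule_zero E D hζ ht]
      exact Module.length_eq_zero
    | succ m ih =>
      rw [length_levelSubmodule_succ E D hζ m (L m) (hL m), ih]
      dsimp only
      rw [Finset.sum_range_succ, Nat.cast_add, add_comm]
  · induction m with
    | zero => simp
    | succ m ih =>
      have h := congrArg (Int.cast : ℤ → ℝ) (hLcard m)
      rw [Int.cast_natCast] at h
      dsimp only at ih ⊢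
      rw [Finset.sum_range_succ, Nat.cast_add, ih, h]
      push_cast
      ring

lemma IsSemiInvariantModule.tendsto (E : IsSemiInvariantModule ζ n a t X ι)
    (D : IsHJData n a r α) (han : a < n) (hζ : IsPrimitiveRoot ζ n) (ht : t < n) :
    Tendsto (hilbertSamuelRatio (invariantRing ζ a) X) atTop
      (𝓝 (∑ u ∈ Finset.Icc 1 r, (α u : ℝ) - 2 * ((r : ℝ) - 1))) := by
  obtain ⟨l, hl, hl2⟩ := E.length_quotient D hζ ht
  exact tendsto_hilbertSamuelRatio (dim_invariantRing D han hζ) l hl hl2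

lemma IsSemiInvariantModule.mu_eq (E : IsSemiInvariantModule ζ n a t X ι)
    (D : IsHJData n a r α) (hζ : IsPrimitiveRoot ζ n) (ht : t < n) :
    (mu (invariantRing ζ a) X : ℝ) =
      ((∑ u ∈ Finset.Icc 1 r, digit (iSeries n a α) t u : ℤ) : ℝ) + 1 := by
  obtain ⟨l, hl, hl2⟩ := E.length_quotient D hζ ht
  -- At m = 1 the quadratic term of the Hilbert–Samuel function vanishes.
  have h1 := hl 1
  rw [pow_one] at h1
  rw [mu_eq_of_length h1, hl2]
  simp

end Filtration

end CyclicQuotient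

/-! ### The main theorem -/

theorem corollary3p3 {k : Type*} [Field k] [IsAlgClosed k]
    (n a : ℕ) (ha : 1 ≤ a) (han : a < n) (hcop : Nat.Coprime a n) (hn : (n : k) ≠ 0)
    (ζ : k) (hζ : IsPrimitiveRoot ζ n)
    (r : ℕ) (α : ℕ → ℕ) (hα : CyclicQuotient.IsHJExpansion n a r α)
    (t : ℕ) (ht : t < n) :
    let R := CyclicQuotient.invariantRing ζ a
    let Mt := CyclicQuotient.M ζ a t
    let eR : ℝ := CyclicQuotient.mult R R
    let d : ℕ → ℤ := CyclicQuotient.digit (CyclicQuotient.iSeries n a α) t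
    -- the limits that define `e(R)` and `e(M_t)` exist
    Filter.Tendsto (CyclicQuotient.hilbertSamuelRatio R R) Filter.atTop (nhds eR) ∧
    Filter.Tendsto (CyclicQuotient.hilbertSamuelRatio R Mt) Filter.atTop
      (nhds (CyclicQuotient.mult R Mt)) ∧
    eR = (∑ u ∈ Finset.Icc 1 r, (α u : ℝ)) - 2 * ((r : ℝ) - 1) ∧
    (∀ s : ℕ, (s : ℝ) ≤ eR - 1 →
      ((CyclicQuotient.mu R Mt : ℝ) = eR - s ↔
        ((∑ u ∈ Finset.Icc 1 r, d u : ℤ) : ℝ) = eR - (s + 1))) ∧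
    (CyclicQuotient.IsUlrich R Mt ↔
      ((∑ u ∈ Finset.Icc 1 r, d u : ℤ) : ℝ) = eR - 1) := by
  intro R Mt eR d
  have D := hα.isHJData ha han hcop
  have hR := (CyclicQuotient.isSemiInvariantModule_invariantRing (a := a) D.n_pos hζ).tendsto
    D han hζ D.n_pos
  have E := CyclicQuotient.isSemiInvariantModule_M (a := a) D.n_pos hζ t
  have hM := E.tendsto D han hζ ht
  have heR : eR = _ := hR.limUnder_eq
  have heM : CyclicQuotient.mult R Mt = _ := hM.limUnder_eq
  have hmu := E.mu_eq D hζ ht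
  have hmu' : (CyclicQuotient.mu R Mt : ℝ) = ((∑ u ∈ Finset.Icc 1 r, d u : ℤ) : ℝ) + 1 := hmu
  refine ⟨?_, ?_, heR, fun s _ => ?_, ?_⟩
  · rw [heR]
    exact hR
  · rw [heM]
    exact hM
  · rw [hmu']
    constructor <;> intro h <;> linarith
  · constructor
    · intro h
      have := h.mu_eq
      rw [heM, ← heR, hmu'] at this
      linarith
    · intro h
      -- Every M_t is maximal Cohen–Macaulay and e(M_t) = e(R), so the Ulrich condition is the case
      -- s = 0.
      refine ⟨E.isMCM D han hζ, ?_⟩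
      rw [heM, ← heR, hmu']
      linarith
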